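/- Let $k$ be a field. All quivers below are finite, $kQ$ denotes the path algebra of $Q$ (paths are composed like maps, so in $\alpha\beta$ the arrow $\beta$ comes first), and algebras are considered up to isomorphism of $k$-algebras. Trivial extension. For a finite-dimensional $k$-algebra $A$ let $DA=\operatorname{Hom}_k(A,k)$ be the $A$-$A$-bimodule with $(afb)(x)=f(bxa)$. The trivial extension $T(A)$ is the vector space $A\oplus DA$ with the multiplication $(a,f)(b,g)=(ab,\,ag+fb)$. Pedigrees. Consider the infinite rooted binary tree with root $\omega$ in which every point $x$ has two children $x'$ and $x''$, made into a quiver by arrows $\beta_x\colon x'\to x$ and $\alpha_x\colon x\to x''$. A pedigree $L$ is a finite subtree (with the arrows between its points) containing $\omega$. The pedigree algebra $A_L$ is the quotient of $kL$ by the ideal generated by all the paths $\alpha_x\beta_x$ for which $x',x,x''$ belong to $L$. Brauer-quivers. A cycle of length $n\ge 1$ in a quiver is a closed path of length $n$ leading through $n$ distinct points, considered up to the choice of its starting point. A Brauer-quiver is a finite, non-empty, connected quiver $Q$ such that each arrow occurs in a cycle, each point belongs to exactly two cycles, and any two different cycles have at most one point in common. For a point $x$ on a cycle $Z$ let $\zeta(x,Z)$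 be the path running once through $Z$ from $x$ to $x$. The Brauer-quiver algebra $B(Q)$ is the quotient of $kQ$ by the ideal generated by all paths of length two that do not lie on a cycle (a path of length two lies on a cycle if both of its arrows occur in that cycle) and by the elements $\zeta(x,Z)-\zeta(x,Z')$, where $x$ is a point and $Z,Z'$ are the two cycles containing $x$. Theorem. (a) For every pedigree $L$ there is a Brauer-quiver $Q$ such that the $k$-algebras $T(A_L)$ and $B(Q)$ are isomorphic. (b) For every Brauer-quiver $Q$ there is a pedigree $L$ such that the $k$-algebras $B(Q)$ and $T(A_L)$ are isomorphic. -/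

import Mathlib

universe u v w

noncomputable section

/-! ### Path algebras -/

/-- Generators of the path algebra of a quiver: a trivial path for each point, and the arrows. -/
inductive PathGen (V : Type u) [Quiver.{v} V] : Type (max u v)
  | point (x : V) : PathGen V
  | arrow (a : Quiver.Total V) : PathGen V

/-- The defining relations of the path algebra: the trivial paths are orthogonal idempotents
with sum `1`, and an arrow `a : x ⟶ y` satisfies `e_y a = a = a e_x`.  Products are written like
compositions of maps: in `b * a` the arrow `a` comes first. -/
inductive PathRel (k : Type w) [Field k] (V : Type u) [Fintype V] [Quiver.{v} V] :
    FreeAlgebra k (PathGen V) → FreeAlgebra k (PathGen V) → Prop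
  | idem (x : V) :
      PathRel k V (FreeAlgebra.ι k (.point x) * FreeAlgebra.ι k (.point x))
        (FreeAlgebra.ι k (.point x))
  | orth (x y : V) (h : x ≠ y) :
      PathRel k V (FreeAlgebra.ι k (.point x) * FreeAlgebra.ι k (.point y)) 0
  | sum : PathRel k V (∑ x : V, FreeAlgebra.ι k (.point x)) 1
  | target (a : Quiver.Total V) :
      PathRel k V (FreeAlgebra.ι k (.point a.right) * FreeAlgebra.ι k (.arrow a))
        (FreeAlgebra.ι k (.arrow a))
  | source (a : Quiver.Total V) :
      PathRel k V (FreeAlgebra.ι k (.arrow a) * FreeAlgebra.ι k (.point a.left))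
        (FreeAlgebra.ι k (.arrow a))

/-- The path algebra `kQ` of a quiver with finitely many points. -/
abbrev PathAlgebra (k : Type w) [Field k] (V : Type u) [Fintype V] [Quiver.{v} V] :
    Type (max u v w) :=
  RingQuot (PathRel k V)

/-- An arrow as an element of the path algebra. -/
def PathAlgebra.arrow (k : Type w) [Field k] {V : Type u} [Fintype V] [Quiver.{v} V]
    (a : Quiver.Total V) : PathAlgebra k V :=
  RingQuot.mkAlgHom k (PathRel k V) (FreeAlgebra.ι k (.arrow a))

/-- The path `aₙ ⋯ a₂ a₁` running first through `a₁`, then through `a₂`, and so on, for the list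
`[a₁, a₂, …, aₙ]` of consecutive arrows. -/
def PathAlgebra.path (k : Type w) [Field k] {V : Type u} [Fintype V] [Quiver.{v} V]
    (l : List (Quiver.Total V)) : PathAlgebra k V :=
  (l.map (PathAlgebra.arrow k)).reverse.prod

/-! ### Trivial extensions -/

/-- The `A`-`A`-bimodule `DA = Hom_k(A, k)` with `(a f b)(x) = f (b x a)`. -/
def DualBimodule (k : Type w) [Field k] (A : Type u) [Ring A] [Algebra k A] : Type (max u w) :=
  A →ₗ[k] k

namespace DualBimodule

variable {k : Type w} [Field k] {A : Type u} [Ring A] [Algebra k A]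

instance : AddCommGroup (DualBimodule k A) := inferInstanceAs (AddCommGroup (A →ₗ[k] k))

instance : Module k (DualBimodule k A) := inferInstanceAs (Module k (A →ₗ[k] k))

instance : FunLike (DualBimodule k A) A k := inferInstanceAs (FunLike (A →ₗ[k] k) A k)

theorem ext' {f g : DualBimodule k A} (h : ∀ x, f x = g x) : f = g := DFunLike.ext f g h

theorem add_apply' (f g : DualBimodule k A) (x : A) : (f + g) x = f x + g x := rfl

theorem zero_apply' (x : A) : (0 : DualBimodule k A) x = 0 := rfl

theorem smul_apply' (c : k) (f : DualBimodule k A) (x : A) : (c • f) x = c * f x := rfl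

theorem map_add' (f : DualBimodule k A) (x y : A) : f (x + y) = f x + f y :=
  LinearMap.map_add (show A →ₗ[k] k from f) x y

theorem map_zero' (f : DualBimodule k A) : f 0 = 0 :=
  LinearMap.map_zero (show A →ₗ[k] k from f)

theorem map_smul' (f : DualBimodule k A) (c : k) (x : A) : f (c • x) = c * f x :=
  LinearMap.map_smul (show A →ₗ[k] k from f) c x

/-- The left action `(a f)(x) = f (x a)`. -/
instance : SMul A (DualBimodule k A) :=
  ⟨fun a f => (show A →ₗ[k] k from f).comp (LinearMap.mulRight k a)⟩

/-- The right action `(f a)(x) = f (a x)`. -/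
instance : SMul Aᵐᵒᵖ (DualBimodule k A) :=
  ⟨fun a f => (show A →ₗ[k] k from f).comp (LinearMap.mulLeft k a.unop)⟩

theorem left_smul_apply (a : A) (f : DualBimodule k A) (x : A) : (a • f) x = f (x * a) := rfl

theorem right_smul_apply (a : Aᵐᵒᵖ) (f : DualBimodule k A) (x : A) :
    (a • f) x = f (a.unop * x) := rfl

instance : Module A (DualBimodule k A) where
  one_smul f := ext' fun x => by rw [left_smul_apply, mul_one]
  mul_smul a b f := ext' fun x => by simp only [left_smul_apply, mul_assoc]
  smul_zero a := ext' fun x => rfl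
  smul_add a f g := ext' fun x => rfl
  add_smul a b f := ext' fun x => by
    simp only [left_smul_apply, add_apply', mul_add, map_add']
  zero_smul f := ext' fun x => by
    simp only [left_smul_apply, mul_zero, map_zero', zero_apply']

instance : Module Aᵐᵒᵖ (DualBimodule k A) where
  one_smul f := ext' fun x => by rw [right_smul_apply, MulOpposite.unop_one, one_mul]
  mul_smul a b f := ext' fun x => by
    simp only [right_smul_apply, MulOpposite.unop_mul, mul_assoc]
  smul_zero a := ext' fun x => rfl
  smul_add a f g := ext' fun x => rfl
  add_smul a b f := ext' fun x => by
    simp only [right_smul_apply, add_apply', MulOpposite.unop_add, add_mul, map_add']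
  zero_smul f := ext' fun x => by
    simp only [right_smul_apply, MulOpposite.unop_zero, zero_mul, map_zero', zero_apply']

instance : SMulCommClass A Aᵐᵒᵖ (DualBimodule k A) where
  smul_comm a b f := ext' fun x => by
    simp only [left_smul_apply, right_smul_apply, mul_assoc]

instance : IsScalarTower k A (DualBimodule k A) where
  smul_assoc c a f := ext' fun x => by
    simp only [left_smul_apply, smul_apply', mul_smul_comm, map_smul']

instance : IsScalarTower k Aᵐᵒᵖ (DualBimodule k A) where
  smul_assoc c a f := ext' fun x => by
    simp only [right_smul_apply, smul_apply', MulOpposite.unop_smul, smul_mul_assoc, map_smul']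

end DualBimodule

/-- The trivial extension `T(A) = A ⊕ DA` with `(a, f)(b, g) = (ab, ag + fb)`. -/
abbrev TrivialExtension (k : Type w) [Field k] (A : Type u) [Ring A] [Algebra k A] :
    Type (max u w) :=
  TrivSqZeroExt A (DualBimodule k A)

/-! ### Pedigrees -/

/-- The two kinds of steps in a walk starting at the root: along an `α`-arrow, or backwards along
a `β`-arrow. -/
inductive PedigreeStep : Type
  | alpha
  | betaInv
  deriving DecidableEq

/-- A pedigree: a finite subtree, containing the root, of the infinite binary tree in which each
point `x` has the two children `x'` and `x''`, with arrows `β_x : x' ⟶ x` and `α_x : x ⟶ x''`.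
A point is identified with the walk leading to it from the root `[]`; as a word this walk is read
from the right to the left, so `x'` is `betaInv :: x` and `x''` is `alpha :: x`. -/
structure Pedigree where
  /-- The points. -/
  points : Finset (List PedigreeStep)
  root_mem : [] ∈ points
  parent_mem : ∀ (s : PedigreeStep) (x : List PedigreeStep), s :: x ∈ points → x ∈ points

namespace Pedigree

/-- The type of points of a pedigree. -/
abbrev Point (L : Pedigree) : Type := {x : List PedigreeStep // x ∈ L.points}

/-- The arrows of a pedigree. -/
inductive Arrow (L : Pedigree) : L.Point → L.Point → Type
  | alpha (x : L.Point) (h : PedigreeStep.alpha :: x.1 ∈ L.points) : Arrow L x ⟨_, h⟩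
  | beta (x : L.Point) (h : PedigreeStep.betaInv :: x.1 ∈ L.points) : Arrow L ⟨_, h⟩ x

instance (L : Pedigree) : Quiver.{0} L.Point := ⟨L.Arrow⟩

/-- The zero-relations `α_x β_x = 0`; these are all the paths `αβ` that occur in `L`. -/
inductive Rel (k : Type w) [Field k] (L : Pedigree) :
    PathAlgebra k L.Point → PathAlgebra k L.Point → Prop
  | alpha_beta (x : L.Point) (h' : PedigreeStep.betaInv :: x.1 ∈ L.points)
      (h'' : PedigreeStep.alpha :: x.1 ∈ L.points) :
      Rel k L (PathAlgebra.path k [⟨_, _, Arrow.beta x h'⟩, ⟨_, _, Arrow.alpha x h''⟩]) 0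

/-- The pedigree algebra `A_L`. -/
abbrev algebra (k : Type w) [Field k] (L : Pedigree) : Type w := RingQuot (L.Rel k)

end Pedigree

/-! ### Brauer-quivers -/

/-- A cycle of length `n ≥ 1` in a quiver: a closed path of length `n` leading through `n`
points, up to the choice of its starting point. -/
structure IsQuiverCycle {V : Type u} [Quiver.{v} V] (Z : Cycle (Quiver.Total V)) : Prop where
  ne_nil : Z ≠ Cycle.nil
  chain : Z.Chain fun a b => a.right = b.left
  nodup : (Z.map Quiver.Total.left).Nodup

/-- A Brauer-quiver: a finite connected quiver such that each arrow occurs in a cycle, each point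
belongs to exactly two cycles, and two different cycles have at most one point in common. -/
structure BrauerQuiver where
  /-- The points. -/
  Point : Type u
  [fintypePoint : Fintype Point]
  [quiver : Quiver.{v} Point]
  finite_arrows : Finite (Quiver.Total Point)
  nonempty : Nonempty Point
  connected : ∀ x y : Point, Relation.EqvGen (fun a b => Nonempty (a ⟶ b)) x y
  arrow_mem_cycle : ∀ a : Quiver.Total Point, ∃ Z : Cycle (Quiver.Total Point),
    IsQuiverCycle Z ∧ a ∈ Z
  two_cycles : ∀ x : Point, {Z : Cycle (Quiver.Total Point) |
    IsQuiverCycle Z ∧ x ∈ Z.map Quiver.Total.left}.ncard = 2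
  meet : ∀ Z Z' : Cycle (Quiver.Total Point), IsQuiverCycle Z → IsQuiverCycle Z' → Z ≠ Z' →
    ∀ x y : Point, x ∈ Z.map Quiver.Total.left → x ∈ Z'.map Quiver.Total.left →
      y ∈ Z.map Quiver.Total.left → y ∈ Z'.map Quiver.Total.left → x = y

namespace BrauerQuiver

attribute [instance] BrauerQuiver.fintypePoint BrauerQuiver.quiver

/-- The relations of the Brauer-quiver algebra.  In `zero`, a path `ba` of length two lies on a
cycle iff both arrows occur in that cycle, because no two arrows of a cycle start in the same
point.  In `zeta`, the lists `a :: l` and `a' :: l'` are the paths `ζ(x, Z)` and `ζ(x, Z')` running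
once through two cycles from their common point `x = a.left = a'.left` to itself. -/
inductive Rel (k : Type w) [Field k] (Q : BrauerQuiver.{u, v}) :
    PathAlgebra k Q.Point → PathAlgebra k Q.Point → Prop
  | zero (a b : Quiver.Total Q.Point) (hab : a.right = b.left)
      (h : ¬ ∃ Z : Cycle (Quiver.Total Q.Point), IsQuiverCycle Z ∧ a ∈ Z ∧ b ∈ Z) :
      Rel k Q (PathAlgebra.path k [a, b]) 0
  | zeta (a a' : Quiver.Total Q.Point) (l l' : List (Quiver.Total Q.Point))
      (hZ : IsQuiverCycle (↑(a :: l) : Cycle (Quiver.Total Q.Point)))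
      (hZ' : IsQuiverCycle (↑(a' :: l') : Cycle (Quiver.Total Q.Point)))
      (hx : a.left = a'.left) :
      Rel k Q (PathAlgebra.path k (a :: l)) (PathAlgebra.path k (a' :: l'))

/-- The Brauer-quiver algebra `B(Q)`. -/
abbrev algebra (k : Type w) [Field k] (Q : BrauerQuiver.{u, v}) : Type (max u v w) :=
  RingQuot (Q.Rel k)

end BrauerQuiver

end

/-!
Call a maximal path of a pedigree `L` none of whose subpaths is a zero-relation a line, where lines
of length zero are included so that each point lies on two lines, and join the last point of each
line to its first. This turns `L` into a Brauer-quiver: its closed lines are the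
orbits of two permutations of the points, and, as in a cactus, removing a point separates the
remaining points of the two orbits through it. Conversely, start with an arrow of a Brauer-quiver
and walk along its cycles, one kind of cycle forwards and the other backwards, never completing a
cycle. Since every point is a cut point, each point is reached by exactly one such walk, and these
walks form a pedigree.

The algebra of the Brauer-quiver and the trivial extension of `A_L` are then isomorphic because both
are generated by idempotents and arrows which follow the two permutations, have zero products
between different orbits, and have the same product along the two orbits through a point. The
paths within the lines form a basis of `A_L`. In the trivial extension, the path that closes up such
a path to a full turn of its orbit is dual to it. So a family of paths that spans the algebra of
the Brauer-quiver is mapped to a basis of the trivial extension.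
-/

noncomputable section

section Word

variable {α : Type*}

theorem suffix_or_suffix_or_exists_ne (u v : List α) :
    u <:+ v ∨ v <:+ u ∨ ∃ z c d, c ≠ d ∧ c :: z <:+ u ∧ d :: z <:+ v := by
  induction u with
  | nil => exact Or.inl v.nil_suffix
  | cons a u ih =>
    rcases ih with ⟨w, rfl⟩ | hvu | ⟨z, c, d, hcd, hu, hv⟩
    · rcases w.eq_nil_or_concat with rfl | ⟨w, b, rfl⟩
      · exact Or.inr (Or.inl (u.suffix_cons a))
      · by_cases hab : a = b
        · exact Or.inl ⟨w, by simp [hab]⟩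
        · exact Or.inr (Or.inr ⟨u, a, b, hab, List.suffix_rfl, w, by simp⟩)
    · exact Or.inr (Or.inl (hvu.trans (u.suffix_cons a)))
    · exact Or.inr (Or.inr ⟨z, c, d, hcd, hu.trans (u.suffix_cons a), hv⟩)

variable [DecidableEq α]

theorem dropWhile_beq_ne_cons (c : α) (x y : List α) : x.dropWhile (· == c) ≠ c :: y := by
  intro h
  have hhead := List.head?_dropWhile_not (· == c) x
  simp [h] at hhead

theorem exists_eq_replicate_append_dropWhile_beq (c : α) (x : List α) :
    ∃ n, x = List.replicate n c ++ x.dropWhile (· == c) := by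
  refine ⟨(x.takeWhile (· == c)).length, ?_⟩
  rw [← List.eq_replicate_of_mem fun b hb => ?_, List.takeWhile_append_dropWhile]
  simpa using List.mem_takeWhile_imp hb

theorem eq_or_cons_suffix_of_dropWhile_beq_eq {c : α} {x y : List α}
    (h : x.dropWhile (· == c) = y.dropWhile (· == c)) :
    x = y ∨ c :: x <:+ y ∨ c :: y <:+ x := by
  have cons_suffix {z : List α} {m n : ℕ} (hmn : m < n) :
      c :: (List.replicate m c ++ z) <:+ List.replicate n c ++ z :=
    ⟨List.replicate (n - (m + 1)) c, by
      rw [← List.cons_append, ← List.replicate_succ, ← List.append_assoc, ← List.replicate_add,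
        Nat.sub_add_cancel hmn]⟩
  obtain ⟨m, hx⟩ := exists_eq_replicate_append_dropWhile_beq c x
  obtain ⟨n, hy⟩ := exists_eq_replicate_append_dropWhile_beq c y
  rw [hx, hy, h]
  rcases lt_trichotomy m n with hmn | rfl | hmn
  · exact Or.inr (Or.inl (cons_suffix hmn))
  · exact Or.inl rfl
  · exact Or.inr (Or.inr (cons_suffix hmn))

theorem dropWhile_beq_eq_self_or_eq_cons (c : α) (x : List α) :
    x.dropWhile (· == c) = x ∨ ∃ y, x = c :: y := by
  rcases x with _ | ⟨d, x⟩
  · exact Or.inl rfl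
  · by_cases h : d = c <;> simp [h]

theorem dropWhile_beq_eq_of_suffix {c : α} {x y : List α} (hy : y <:+ x)
    (h : x.dropWhile (· == c) <:+ y) : y.dropWhile (· == c) = x.dropWhile (· == c) := by
  induction x with
  | nil => rw [List.suffix_nil.1 hy]
  | cons d x ih =>
    rcases List.suffix_cons_iff.1 hy with rfl | hyx
    · rfl
    · by_cases hd : d = c
      · rw [List.dropWhile_cons_of_pos (by simpa using hd)] at h ⊢
        exact ih hyx h
      · rw [List.dropWhile_cons_of_neg (by simpa using hd)] at h
        exact absurd (h.trans hyx).length_le (by simp)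

theorem cons_suffix_dropWhile_beq_iff {c d : α} {x p : List α} (hp : ∀ q, p ≠ d :: q)
    (h : x.dropWhile (· == c) ≠ p) : d :: p <:+ x.dropWhile (· == c) ↔ d :: p <:+ x := by
  refine ⟨fun hd => hd.trans (List.dropWhile_suffix _), fun hd => ?_⟩
  rcases List.suffix_or_suffix_of_suffix hd (List.dropWhile_suffix (· == c)) with hd' | hd'
  · exact hd'
  rw [← dropWhile_beq_eq_of_suffix hd hd'] at h ⊢
  rcases dropWhile_beq_eq_self_or_eq_cons c (d :: p) with hself | ⟨q, heq⟩
  · rw [hself]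
  · obtain ⟨rfl, rfl⟩ := List.cons.inj heq
    rcases dropWhile_beq_eq_self_or_eq_cons d p with hself | ⟨q, rfl⟩
    · exact absurd (by simpa using hself) h
    · exact absurd rfl (hp q)

end Word

/-! ### Cacti -/

/-- Permutations `s c` of a set `X`, each point of which lies over a point of `V`, form a cactus if
every orbit is mapped injectively to `V` and every point `p` splits the rest of `V` into sides, one
for each `c`: the orbit of `p` under `s c` lies on the side `c`, and no other orbit leads from one
side to another without passing through `p`. -/
structure IsCactus {ι X V : Type*} (s : ι → Equiv.Perm X) (π : X → V) : Prop where
  eq_of_sameCycle : ∀ {c x y}, (s c).SameCycle x y → π x = π y → x = y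
  exists_side : ∀ p, ∃ side : V → ι, (∀ c, π (s c p) ≠ π p → side (π (s c p)) = c) ∧
    ∀ c x, π x ≠ π p → π (s c x) ≠ π p → side (π (s c x)) = side (π x)

namespace IsCactus

variable {ι X V : Type*} {s t : ι → Equiv.Perm X} {π : X → V}

theorem exists_sameCycle_side [Finite X] (h : IsCactus s π) (p : X) : ∃ side : V → ι,
    (∀ c x, (s c).SameCycle p x → π x ≠ π p → side (π x) = c) ∧
      ∀ c x, π x ≠ π p → π (s c x) ≠ π p → side (π (s c x)) = side (π x) := by
  obtain ⟨side, hp, hside⟩ := h.exists_side p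
  refine ⟨side, fun c x hx => ?_, hside⟩
  obtain ⟨n, rfl⟩ := hx.exists_nat_pow_eq
  clear hx
  induction n with
  | zero => exact fun hne => absurd rfl hne
  | succ n ih =>
    rw [pow_succ', Equiv.Perm.mul_apply]
    intro hne
    by_cases hn : π ((s c ^ n) p) = π p
    · have hpn : p = (s c ^ n) p := h.eq_of_sameCycle ⟨n, rfl⟩ hn.symm
      rw [← hpn] at hne ⊢
      exact hp c hne
    · rw [hside c _ hn hne, ih hn]

theorem of_eq_or_inv [Finite X] (h : IsCactus s π) (ht : ∀ c, t c = s c ∨ t c = (s c)⁻¹) :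
    IsCactus t π where
  eq_of_sameCycle {c x y} hxy := by
    rcases ht c with hc | hc <;> rw [hc] at hxy
    · exact h.eq_of_sameCycle hxy
    · exact h.eq_of_sameCycle (Equiv.Perm.sameCycle_inv.1 hxy)
  exists_side p := by
    obtain ⟨side, hp, hside⟩ := h.exists_sameCycle_side p
    refine ⟨side, fun c => hp c _ ?_, fun c x hx => ?_⟩ <;> rcases ht c with hc | hc <;> rw [hc]
    · exact ⟨1, rfl⟩
    · exact ⟨-1, rfl⟩
    · exact hside c x hx
    · intro hx'
      simpa using (hside c ((s c)⁻¹ x) hx' (by simpa using hx)).symm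

end IsCactus

/-! ### Simple walks in a cactus -/

section Walk

variable {ι X V : Type*} (s : ι → Equiv.Perm X) (π : X → V) (e : X)

/-- The end of the walk from `e` that follows the letters of a word, read from the right to the
left. -/
def walk : List ι → X
  | [] => e
  | c :: w => s c (walk w)

/-- A walk is simple if its points lie over different points of `V`. -/
def IsSimpleWalk (w : List ι) : Prop :=
  Set.InjOn (fun u => π (walk s e u)) {u | u <:+ w}

variable {s π e}

theorem IsSimpleWalk.of_suffix {u w : List ι} (hw : IsSimpleWalk s π e w) (h : u <:+ w) :
    IsSimpleWalk s π e u :=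
  hw.mono fun _ hv => hv.trans h

theorem isSimpleWalk_nil : IsSimpleWalk s π e [] := by
  simp [IsSimpleWalk]

theorem IsSimpleWalk.ne_of_cons_suffix {c : ι} {u w : List ι} (hw : IsSimpleWalk s π e w)
    (h : c :: u <:+ w) : π (walk s e w) ≠ π (walk s e u) := by
  intro heq
  have hlen := h.length_le
  rw [hw List.suffix_rfl ((u.suffix_cons c).trans h) heq, List.length_cons] at hlen
  omega

theorem exists_suffix_of_not_isSimpleWalk_cons {c : ι} {x : List ι} (hx : IsSimpleWalk s π e x)
    (h : ¬ IsSimpleWalk s π e (c :: x)) :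
    ∃ y, y <:+ x ∧ π (s c (walk s e x)) = π (walk s e y) := by
  by_contra! hne
  refine h fun u hu v hv huv => ?_
  rcases List.suffix_cons_iff.1 hu with rfl | hu <;> rcases List.suffix_cons_iff.1 hv with rfl | hv
  · rfl
  · exact absurd huv (hne v hv)
  · exact absurd huv.symm (hne u hu)
  · exact hx hu hv huv

theorem side_walk_eq {side : V → ι} {v : V}
    (hside : ∀ c x, π x ≠ v → π (s c x) ≠ v → side (π (s c x)) = side (π x)) {y w : List ι}
    (hyw : y <:+ w) (hv : ∀ u, y <:+ u → u <:+ w → π (walk s e u) ≠ v) :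
    side (π (walk s e w)) = side (π (walk s e y)) := by
  induction w with
  | nil => rw [List.suffix_nil.1 hyw]
  | cons c w ih =>
    rcases List.suffix_cons_iff.1 hyw with rfl | hy
    · rfl
    · have hw := w.suffix_cons c
      exact (hside c _ (hv w hy hw) (hv _ hyw List.suffix_rfl)).trans
        (ih hy fun u hyu huw => hv u hyu (huw.trans hw))

theorem IsCactus.eq_of_isSimpleWalk (h : IsCactus s π) {u v : List ι}
    (hu : IsSimpleWalk s π e u) (hv : IsSimpleWalk s π e v)
    (huv : π (walk s e u) = π (walk s e v)) : u = v := by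
  rcases suffix_or_suffix_or_exists_ne u v with hsuff | hsuff | ⟨z, c, d, hcd, hcu, hdv⟩
  · exact hv hsuff List.suffix_rfl huv
  · exact hu List.suffix_rfl hsuff huv
  · obtain ⟨side, hp, hside⟩ := h.exists_side (walk s e z)
    have side_eq {b : ι} {w : List ι} (hw : IsSimpleWalk s π e w) (hb : b :: z <:+ w) :
        side (π (walk s e w)) = b :=
      (side_walk_eq hside hb fun y hy hyw => (hw.of_suffix hyw).ne_of_cons_suffix hy).trans
        (hp b ((hw.of_suffix hb).ne_of_cons_suffix List.suffix_rfl))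
    exact absurd ((side_eq hu hcu).symm.trans ((congrArg side huv).trans (side_eq hv hdv))) hcd

theorem walk_sameCycle_dropWhile_beq [DecidableEq ι] (c : ι) (w : List ι) :
    (s c).SameCycle (walk s e (w.dropWhile (· == c))) (walk s e w) := by
  induction w with
  | nil => rfl
  | cons d w ih =>
    by_cases hd : d = c
    · subst hd
      simpa [walk] using ih
    · simp [hd, Equiv.Perm.SameCycle.rfl]

theorem IsCactus.walk_dropWhile_beq_eq [Finite X] [DecidableEq ι] (h : IsCactus s π) {c : ι}
    {x : List ι} (hx : IsSimpleWalk s π e x) (hcx : ¬ IsSimpleWalk s π e (c :: x)) :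
    walk s e (x.dropWhile (· == c)) = s c (walk s e x) := by
  obtain ⟨y, hyx, hy⟩ := exists_suffix_of_not_isSimpleWalk_cons hx hcx
  have hline : (s c).SameCycle (walk s e (x.dropWhile (· == c))) (s c (walk s e x)) :=
    Equiv.Perm.sameCycle_apply_right.2 (walk_sameCycle_dropWhile_beq c x)
  have hzx := List.dropWhile_suffix (l := x) (· == c)
  rcases List.suffix_or_suffix_of_suffix hzx hyx with hzy | hyz
  · have hdrop := dropWhile_beq_eq_of_suffix hyx hzy
    have hwalk : walk s e y = s c (walk s e x) := by
      refine h.eq_of_sameCycle (.trans (.symm ?_) hline) hy.symm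
      rw [← hdrop]
      exact walk_sameCycle_dropWhile_beq c y
    rcases dropWhile_beq_eq_self_or_eq_cons c y with hself | ⟨y', rfl⟩
    · rw [← hwalk, ← hdrop, hself]
    · exact absurd (congrArg π ((s c).injective hwalk)) (hx.ne_of_cons_suffix hyx).symm
  · generalize hz : x.dropWhile (· == c) = z at *
    rcases z with _ | ⟨d, z⟩
    · exact h.eq_of_sameCycle hline (by rw [hy, List.suffix_nil.1 hyz])
    rcases List.suffix_cons_iff.1 hyz with rfl | hyz
    · exact h.eq_of_sameCycle hline hy.symm
    -- If the walk met itself strictly before `d :: z`, the point where it does so would lie on two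
    -- sides of the end of `d :: z`: on the side `d` from which the walk came and on the side `c`.
    obtain ⟨side, hp, hside⟩ := h.exists_sameCycle_side (walk s e (d :: z))
    have hne {u : List ι} (hu : u <:+ z) : π (walk s e u) ≠ π (walk s e (d :: z)) := by
      intro heq
      obtain rfl := (hx.of_suffix hzx) (hu.trans (z.suffix_cons d)) List.suffix_rfl heq
      exact absurd hu.length_le (by simp)
    have hd : side (π (walk s e y)) = d := by
      rw [← side_walk_eq hside hyz fun u _ hu => hne hu]
      exact hp d _ (Equiv.Perm.sameCycle_apply_left.2 .rfl) (hne List.suffix_rfl)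
    have hc : side (π (walk s e y)) = c := by
      rw [← hy]
      exact hp c _ hline (hy ▸ hne hyz)
    exact absurd hz (by rw [← hd, hc]; exact dropWhile_beq_ne_cons c x z)

end Walk

/-! ### The lines of a pedigree -/

namespace Pedigree

variable {L : Pedigree}

theorem mem_points_of_suffix {x y : List PedigreeStep} (h : x <:+ y) (hy : y ∈ L.points) :
    x ∈ L.points := by
  obtain ⟨z, rfl⟩ := h
  induction z with
  | nil => exact hy
  | cons s z ih => exact ih (L.parent_mem s _ hy)

variable (L) in
/-- One step away from the root on the line of `x` formed by the steps `c`, returning from the last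
point of the line to the first. -/
def climb (c : PedigreeStep) (x : L.Point) : L.Point :=
  if h : c :: x.1 ∈ L.points then ⟨_, h⟩
  else ⟨x.1.dropWhile (· == c), mem_points_of_suffix (List.dropWhile_suffix _) x.2⟩

theorem climb_of_mem {c : PedigreeStep} {x : L.Point} (h : c :: x.1 ∈ L.points) :
    L.climb c x = ⟨_, h⟩ := dif_pos h

theorem coe_climb_of_notMem {c : PedigreeStep} {x : L.Point} (h : c :: x.1 ∉ L.points) :
    (L.climb c x).1 = x.1.dropWhile (· == c) := by
  rw [climb, dif_neg h]

theorem dropWhile_climb (c : PedigreeStep) (x : L.Point) :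
    (L.climb c x).1.dropWhile (· == c) = x.1.dropWhile (· == c) := by
  by_cases h : c :: x.1 ∈ L.points
  · simp [climb_of_mem h]
  · rw [coe_climb_of_notMem h, List.dropWhile_idempotent]

theorem eq_of_dropWhile_eq {c : PedigreeStep} {x y : L.Point}
    (h : x.1.dropWhile (· == c) = y.1.dropWhile (· == c)) (hx : c :: x.1 ∉ L.points)
    (hy : c :: y.1 ∉ L.points) : x = y := by
  rcases eq_or_cons_suffix_of_dropWhile_beq_eq h with heq | hxy | hyx
  · exact Subtype.ext heq
  · exact absurd (mem_points_of_suffix hxy y.2) hx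
  · exact absurd (mem_points_of_suffix hyx x.2) hy

theorem climb_injective (c : PedigreeStep) : Function.Injective (L.climb c) := by
  intro x y hxy
  have hval := congrArg Subtype.val hxy
  by_cases hx : c :: x.1 ∈ L.points <;> by_cases hy : c :: y.1 ∈ L.points
  · rw [climb_of_mem hx, climb_of_mem hy] at hval
    exact Subtype.ext (List.cons.inj hval).2
  · rw [climb_of_mem hx, coe_climb_of_notMem hy] at hval
    exact absurd hval.symm (dropWhile_beq_ne_cons _ _ _)
  · rw [climb_of_mem hy, coe_climb_of_notMem hx] at hval
    exact absurd hval (dropWhile_beq_ne_cons _ _ _)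
  · exact eq_of_dropWhile_eq (by rw [← dropWhile_climb, hxy, dropWhile_climb]) hx hy

variable (L) in
/-- `climb` as a permutation: its orbits are the lines of the pedigree, closed to cycles. -/
def climbPerm (c : PedigreeStep) : Equiv.Perm L.Point :=
  Equiv.ofBijective _ (Finite.injective_iff_bijective.1 (climb_injective (L := L) c))

@[simp]
theorem climbPerm_apply (c : PedigreeStep) (x : L.Point) : L.climbPerm c x = L.climb c x := rfl

theorem dropWhile_eq_of_sameCycle {c : PedigreeStep} {x y : L.Point}
    (h : (L.climbPerm c).SameCycle x y) : x.1.dropWhile (· == c) = y.1.dropWhile (· == c) := by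
  obtain ⟨n, rfl⟩ := h.exists_nat_pow_eq
  clear h
  induction n with
  | zero => rfl
  | succ n ih => rw [pow_succ', Equiv.Perm.mul_apply, climbPerm_apply, dropWhile_climb, ih]

theorem exists_sameCycle_cons_notMem (c : PedigreeStep) (x : L.Point) :
    ∃ y, (L.climbPerm c).SameCycle x y ∧ c :: y.1 ∉ L.points := by
  obtain ⟨y, hy, hmax⟩ := Set.exists_max_image {y | (L.climbPerm c).SameCycle x y}
    (fun y => y.1.length) (Set.toFinite _) ⟨x, .rfl⟩
  refine ⟨y, hy, fun h => ?_⟩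
  have hlt := hmax (L.climbPerm c y) (Equiv.Perm.sameCycle_apply_right.2 hy)
  simp [climb_of_mem h] at hlt

variable (L) in
/-- The next point on the line of `x` of the given kind, in the direction of the arrows; the last
point of a line is followed by the first one. -/
def next : PedigreeStep → Equiv.Perm L.Point
  | .alpha => L.climbPerm .alpha
  | .betaInv => (L.climbPerm .betaInv)⁻¹

variable (L) in
/-- The arrow from `x` to `L.next c x` is an arrow of the pedigree, that is, `x` is not the last
point of its line. -/
def Inner : PedigreeStep → L.Point → Prop
  | .alpha, x => PedigreeStep.alpha :: x.1 ∈ L.points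
  | .betaInv, x => PedigreeStep.betaInv :: (L.next .betaInv x).1 ∈ L.points

theorem next_eq_or_inv (c : PedigreeStep) :
    L.next c = L.climbPerm c ∨ L.next c = (L.climbPerm c)⁻¹ := by
  cases c
  · exact Or.inl rfl
  · exact Or.inr rfl

theorem climb_next_betaInv (x : L.Point) : L.climb .betaInv (L.next .betaInv x) = x :=
  (L.climbPerm .betaInv).apply_symm_apply x

theorem next_betaInv_climb (x : L.Point) : L.next .betaInv (L.climb .betaInv x) = x :=
  (L.climbPerm .betaInv).symm_apply_apply x

theorem sameCycle_next_iff {c : PedigreeStep} {x y : L.Point} :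
    (L.next c).SameCycle x y ↔ (L.climbPerm c).SameCycle x y := by
  rcases next_eq_or_inv (L := L) c with h | h <;> simp [h]

theorem exists_sameCycle_not_inner (c : PedigreeStep) (x : L.Point) :
    ∃ y, (L.next c).SameCycle x y ∧ ¬ L.Inner c y := by
  obtain ⟨y, hy, h⟩ := exists_sameCycle_cons_notMem c x
  cases c
  · exact ⟨y, hy, h⟩
  · refine ⟨L.climb .betaInv y, sameCycle_next_iff.2 (Equiv.Perm.sameCycle_apply_right.2 hy), ?_⟩
    rwa [Inner, next_betaInv_climb]

theorem eq_of_not_inner {c : PedigreeStep} {x y : L.Point} (h : (L.next c).SameCycle x y)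
    (hx : ¬ L.Inner c x) (hy : ¬ L.Inner c y) : x = y := by
  cases c
  · exact eq_of_dropWhile_eq (dropWhile_eq_of_sameCycle h) hx hy
  · refine (L.next .betaInv).injective (eq_of_dropWhile_eq (dropWhile_eq_of_sameCycle ?_) hx hy)
    exact sameCycle_next_iff.1 (by simpa using h)

/-- The arrow from `x` to the next point of its line of kind `c`. -/
def innerArrow : (c : PedigreeStep) → (x : L.Point) → L.Inner c x → Quiver.Total L.Point
  | .alpha, x, h => ⟨x, ⟨_, h⟩, Arrow.alpha x h⟩
  | .betaInv, x, h => ⟨⟨_, h⟩, L.next .betaInv x, Arrow.beta (L.next .betaInv x) h⟩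

theorem innerArrow_left (c : PedigreeStep) (x : L.Point) (h : L.Inner c x) :
    (innerArrow c x h).left = x := by
  cases c
  · rfl
  · exact (climb_of_mem h).symm.trans (climb_next_betaInv x)

theorem innerArrow_right (c : PedigreeStep) (x : L.Point) (h : L.Inner c x) :
    (innerArrow c x h).right = L.next c x := by
  cases c
  · exact (climb_of_mem h).symm
  · rfl

theorem next_betaInv_of_mem {x : L.Point} (h : PedigreeStep.betaInv :: x.1 ∈ L.points) :
    L.next .betaInv ⟨_, h⟩ = x := by
  rw [← climb_of_mem h, next_betaInv_climb]

theorem inner_betaInv_of_mem {x : L.Point} (h : PedigreeStep.betaInv :: x.1 ∈ L.points) :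
    L.Inner .betaInv ⟨_, h⟩ := by
  rwa [Inner, next_betaInv_of_mem h]

theorem innerArrow_betaInv_of_mem {x : L.Point} (h : PedigreeStep.betaInv :: x.1 ∈ L.points) :
    innerArrow .betaInv ⟨_, h⟩ (inner_betaInv_of_mem h) = ⟨_, _, Arrow.beta x h⟩ := by
  have beta_congr (y : L.Point) (hy : y = x) (h' : PedigreeStep.betaInv :: y.1 ∈ L.points) :
      (⟨_, _, Arrow.beta y h'⟩ : Quiver.Total L.Point) = ⟨_, _, Arrow.beta x h⟩ := by
    subst hy
    rfl
  exact beta_congr _ (next_betaInv_of_mem h) _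

theorem exists_eq_innerArrow (a : Quiver.Total L.Point) : ∃ c x h, a = innerArrow c x h := by
  obtain ⟨_, _, a⟩ := a
  change L.Arrow _ _ at a
  cases a with
  | alpha _ h => exact ⟨.alpha, _, h, rfl⟩
  | beta _ h => exact ⟨.betaInv, _, inner_betaInv_of_mem h, (innerArrow_betaInv_of_mem h).symm⟩

/-! ### The lines of a pedigree form a cactus -/

theorem exists_step_forall_ne_cons (p : List PedigreeStep) : ∃ f g : PedigreeStep, f ≠ g ∧
    (∀ c, c = f ∨ c = g) ∧ ∀ q, p ≠ f :: q := by
  rcases p with _ | ⟨_ | _, p⟩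
  · exact ⟨.alpha, .betaInv, nofun, fun c => by cases c <;> simp, nofun⟩
  · exact ⟨.betaInv, .alpha, nofun, fun c => by cases c <;> simp, nofun⟩
  · exact ⟨.alpha, .betaInv, nofun, fun c => by cases c <;> simp, nofun⟩

theorem cons_suffix_climb_iff {f : PedigreeStep} {p : List PedigreeStep}
    (hf : ∀ q, p ≠ f :: q) (c : PedigreeStep) (x : L.Point) (hx : x.1 ≠ p)
    (hcx : (L.climb c x).1 ≠ p) : f :: p <:+ (L.climb c x).1 ↔ f :: p <:+ x.1 := by
  by_cases h : c :: x.1 ∈ L.points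
  · rw [climb_of_mem h, List.suffix_cons_iff, or_iff_right]
    exact fun heq => hx (List.cons.inj heq).2.symm
  · rw [coe_climb_of_notMem h] at hcx ⊢
    exact cons_suffix_dropWhile_beq_iff hf hcx

theorem cons_suffix_climb_self_iff {f : PedigreeStep} {p : L.Point}
    (hf : ∀ q, p.1 ≠ f :: q) (c : PedigreeStep) (hcp : L.climb c p ≠ p) :
    f :: p.1 <:+ (L.climb c p).1 ↔ c = f := by
  by_cases h : c :: p.1 ∈ L.points
  · rw [climb_of_mem h, List.suffix_cons_iff, or_iff_left fun hp => absurd hp.length_le (by simp)]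
    exact ⟨fun heq => (List.cons.inj heq).1.symm, fun heq => heq ▸ rfl⟩
  · rw [← Subtype.coe_ne_coe, coe_climb_of_notMem h] at hcp
    refine iff_of_false (fun hp => ?_) fun hcf => ?_
    · exact absurd ((hp.trans (coe_climb_of_notMem h ▸ List.dropWhile_suffix _)).length_le)
        (by simp)
    · subst hcf
      rcases dropWhile_beq_eq_self_or_eq_cons c p.1 with hself | ⟨q, hq⟩
      · exact hcp hself
      · exact hf q hq

theorem isCactus_climbPerm (L : Pedigree) : IsCactus L.climbPerm (id : L.Point → L.Point) where
  eq_of_sameCycle _ h := h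
  exists_side p := by
    obtain ⟨f, g, hfg, hletter, hf⟩ := exists_step_forall_ne_cons p.1
    refine ⟨fun y => if f :: p.1 <:+ y.1 then f else g, fun c hc => ?_, fun c x hx hcx => ?_⟩
    · rcases hletter c with rfl | rfl
      · exact if_pos ((cons_suffix_climb_self_iff hf c hc).2 rfl)
      · exact if_neg (mt (cons_suffix_climb_self_iff hf c hc).1 hfg.symm)
    · exact if_congr (cons_suffix_climb_iff hf c x (Subtype.coe_ne_coe.2 hx)
        (Subtype.coe_ne_coe.2 hcx)) rfl rfl

theorem isCactus_next (L : Pedigree) : IsCactus L.next (id : L.Point → L.Point) :=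
  L.isCactus_climbPerm.of_eq_or_inv next_eq_or_inv

end Pedigree

/-! ### The pedigree of simple walks -/

section SimpleWalk

variable {X V : Type*} [Finite V]

theorem IsCactus.finite_isSimpleWalk {ι : Type*} {s : ι → Equiv.Perm X} {π : X → V}
    (h : IsCactus s π) (e : X) :
    {w | IsSimpleWalk s π e w}.Finite :=
  Set.Finite.of_finite_image (f := fun w => π (walk s e w)) (Set.toFinite _)
    fun _ hu _ hv => h.eq_of_isSimpleWalk hu hv

variable {s : PedigreeStep → Equiv.Perm X} {π : X → V}

/-- The pedigree formed by the simple walks in a cactus that start with `e`. -/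
def IsCactus.pedigree (h : IsCactus s π) (e : X) : Pedigree where
  points := (h.finite_isSimpleWalk e).toFinset
  root_mem := (h.finite_isSimpleWalk e).mem_toFinset.2 isSimpleWalk_nil
  parent_mem c x hx := (h.finite_isSimpleWalk e).mem_toFinset.2
    (((h.finite_isSimpleWalk e).mem_toFinset.1 hx).of_suffix (x.suffix_cons c))

theorem IsCactus.mem_pedigree {h : IsCactus s π} {e : X} {x : List PedigreeStep} :
    x ∈ (h.pedigree e).points ↔ IsSimpleWalk s π e x :=
  (h.finite_isSimpleWalk e).mem_toFinset

theorem IsCactus.walk_climb [Finite X] (h : IsCactus s π) {e : X} (c : PedigreeStep)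
    (x : (h.pedigree e).Point) :
    walk s e ((h.pedigree e).climb c x).1 = s c (walk s e x.1) := by
  by_cases hcx : c :: x.1 ∈ (h.pedigree e).points
  · rw [Pedigree.climb_of_mem hcx, walk]
  · rw [Pedigree.coe_climb_of_notMem hcx,
      h.walk_dropWhile_beq_eq (h.mem_pedigree.1 x.2) fun hs => hcx (h.mem_pedigree.2 hs)]

theorem IsCactus.injective_walk_pedigree (h : IsCactus s π) (e : X) :
    Function.Injective fun x : (h.pedigree e).Point => π (walk s e x.1) :=
  fun x y hxy => Subtype.ext
    (h.eq_of_isSimpleWalk (h.mem_pedigree.1 x.2) (h.mem_pedigree.1 y.2) hxy)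

end SimpleWalk

/-! ### The universal property of path algebras -/

namespace PathAlgebra

variable (k : Type w) [Field k] {V : Type u} [Fintype V] [Quiver.{v} V]

/-- The trivial path at a point as an element of the path algebra. -/
def vertex (x : V) : PathAlgebra k V :=
  RingQuot.mkAlgHom k (PathRel k V) (FreeAlgebra.ι k (.point x))

theorem completeOrthogonalIdempotents_vertex :
    CompleteOrthogonalIdempotents (vertex k (V := V)) where
  idem x := by
    simpa [IsIdempotentElem, vertex] using RingQuot.mkAlgHom_rel k (PathRel.idem (k := k) x)
  ortho x y h := by simpa [vertex] using RingQuot.mkAlgHom_rel k (PathRel.orth (k := k) x y h)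
  complete := by simpa [vertex] using RingQuot.mkAlgHom_rel k (PathRel.sum (k := k) (V := V))

theorem vertex_mul_arrow (a : Quiver.Total V) : vertex k a.right * arrow k a = arrow k a := by
  simpa [vertex, arrow] using RingQuot.mkAlgHom_rel k (PathRel.target (k := k) a)

theorem arrow_mul_vertex (a : Quiver.Total V) : arrow k a * vertex k a.left = arrow k a := by
  simpa [vertex, arrow] using RingQuot.mkAlgHom_rel k (PathRel.source (k := k) a)

theorem adjoin_eq_top : Algebra.adjoin k
    (Set.range (vertex k) ∪ Set.range (arrow k) : Set (PathAlgebra k V)) = ⊤ := by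
  have h := congrArg (Subalgebra.map (RingQuot.mkAlgHom k (PathRel k V)))
    (FreeAlgebra.adjoin_range_ι k (PathGen V))
  rw [AlgHom.map_adjoin, Algebra.map_top,
    (AlgHom.range_eq_top _).2 (RingQuot.mkAlgHom_surjective k _)] at h
  rw [eq_top_iff, ← h]
  apply Algebra.adjoin_mono
  rintro _ ⟨_, ⟨x | a, rfl⟩, rfl⟩
  · exact Or.inl ⟨x, rfl⟩
  · exact Or.inr ⟨a, rfl⟩

theorem adjoin_image_eq_top (r : PathAlgebra k V → PathAlgebra k V → Prop) :
    Algebra.adjoin k (Set.range (fun x => RingQuot.mkAlgHom k r (vertex k x)) ∪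
      Set.range fun a => RingQuot.mkAlgHom k r (arrow k a)) = ⊤ := by
  have h := congrArg (Subalgebra.map (RingQuot.mkAlgHom k r)) (adjoin_eq_top k (V := V))
  rwa [AlgHom.map_adjoin, Algebra.map_top,
    (AlgHom.range_eq_top _).2 (RingQuot.mkAlgHom_surjective k _), Set.image_union,
    ← Set.range_comp, ← Set.range_comp] at h

section Lift

variable {k} {R : Type*} [Ring R] [Algebra k R] {e : V → R} {f : Quiver.Total V → R}
  (he : CompleteOrthogonalIdempotents e) (target : ∀ a, e a.right * f a = f a)
  (source : ∀ a, f a * e a.left = f a)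

/-- The algebra homomorphism given by the images of the trivial paths and of the arrows. -/
def lift : PathAlgebra k V →ₐ[k] R :=
  RingQuot.liftAlgHom k ⟨FreeAlgebra.lift k fun g => PathGen.casesOn g e f, by
    intro _ _ h
    cases h with
    | idem x => simpa using (he.idem x).eq
    | orth x y h => simpa using he.ortho h
    | sum => simpa using he.complete
    | target a => simpa using target a
    | source a => simpa using source a⟩

@[simp]
theorem lift_vertex (x : V) : lift he target source (vertex k x) = e x := by
  simp [lift, vertex]

@[simp]
theorem lift_arrow (a : Quiver.Total V) : lift he target source (arrow k a) = f a := by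
  simp [lift, arrow]

end Lift

end PathAlgebra

/-! ### Line systems -/

/-- The shape shared by the algebras of the theorem: on a finite set with permutations `s c`, a
complete family of orthogonal idempotents `e x`, and for each `c` an element `arr c x` from `x` to
`s c x`, such that the product of two arrows of different kinds is zero. -/
structure LineSystem {ι V : Type*} [Fintype V] (s : ι → Equiv.Perm V) (R : Type*) [Ring R] where
  /-- The idempotents. -/
  e : V → R
  /-- The arrows. -/
  arr : ι → V → R
  complete : CompleteOrthogonalIdempotents e
  target : ∀ c x, e (s c x) * arr c x = arr c x
  source : ∀ c x, arr c x * e x = arr c x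
  cross : ∀ {c d}, c ≠ d → ∀ x, arr d (s c x) * arr c x = 0

theorem minimalPeriod_perm_pos {X : Type*} [Finite X] (s : Equiv.Perm X) (x : X) :
    0 < Function.minimalPeriod s x :=
  Function.minimalPeriod_pos_of_mem_periodicPts (s.injective.mem_periodicPts x)

namespace LineSystem

variable {ι V : Type*} [Fintype V] {s : ι → Equiv.Perm V} {R : Type*} [Ring R]
  (S : LineSystem s R)

/-- The product of the `n` consecutive arrows of kind `c` that starts in `x`. -/
def path (c : ι) (x : V) : ℕ → R
  | 0 => S.e x
  | n + 1 => S.arr c ((s c)^[n] x) * path c x n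

@[simp]
theorem path_zero (c : ι) (x : V) : S.path c x 0 = S.e x := rfl

theorem path_succ (c : ι) (x : V) (n : ℕ) :
    S.path c x (n + 1) = S.arr c ((s c)^[n] x) * S.path c x n := rfl

theorem path_one (c : ι) (x : V) : S.path c x 1 = S.arr c x := S.source c x

theorem e_mul_path (c : ι) (x : V) (n : ℕ) :
    S.e ((s c)^[n] x) * S.path c x n = S.path c x n := by
  cases n with
  | zero => exact S.complete.idem x
  | succ n => rw [path_succ, ← mul_assoc, Function.iterate_succ_apply', S.target]

theorem e_mul_path_of_ne {c : ι} {x y : V} {n : ℕ} (h : y ≠ (s c)^[n] x) :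
    S.e y * S.path c x n = 0 := by
  rw [← S.e_mul_path, ← mul_assoc, S.complete.ortho h, zero_mul]

theorem arr_mul_path_of_ne {c d : ι} {x y : V} {n : ℕ} (h : y ≠ (s c)^[n] x) :
    S.arr d y * S.path c x n = 0 := by
  rw [← S.source, mul_assoc, S.e_mul_path_of_ne h, mul_zero]

theorem arr_mul_path_cross {c d : ι} (h : c ≠ d) (x : V) {n : ℕ} (hn : n ≠ 0) :
    S.arr d ((s c)^[n] x) * S.path c x n = 0 := by
  obtain ⟨n, rfl⟩ := Nat.exists_eq_succ_of_ne_zero hn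
  rw [path_succ, ← mul_assoc, Function.iterate_succ_apply', S.cross h, zero_mul]

theorem path_add (c : ι) (x : V) (m n : ℕ) :
    S.path c x (m + n) = S.path c ((s c)^[m] x) n * S.path c x m := by
  induction n with
  | zero => exact (S.e_mul_path c x m).symm
  | succ n ih => rw [← add_assoc, path_succ, ih, path_succ, mul_assoc,
      ← Function.iterate_add_apply, add_comm n m]

theorem path_eq_prod (c : ι) (x : V) {n : ℕ} (hn : n ≠ 0) :
    S.path c x n = ((List.range n).map fun i => S.arr c ((s c)^[i] x)).reverse.prod := by
  obtain ⟨n, rfl⟩ := Nat.exists_eq_succ_of_ne_zero hn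
  clear hn
  induction n with
  | zero => simp [path_one]
  | succ n ih =>
    rw [path_succ, ih, List.range_succ (n := n + 1)]
    simp

variable {S} in
theorem map_path {R' : Type*} [Ring R'] {S' : LineSystem s R'} {F : Type*} [FunLike F R R']
    [MulHomClass F R R'] {f : F} {c : ι} {x : V} {n : ℕ} (he : f (S.e x) = S'.e x)
    (harr : ∀ i < n, f (S.arr c ((s c)^[i] x)) = S'.arr c ((s c)^[i] x)) :
    f (S.path c x n) = S'.path c x n := by
  induction n with
  | zero => exact he
  | succ n ih =>
    rw [path_succ, path_succ, map_mul, harr n n.lt_succ_self,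
      ih fun i hi => harr i (hi.trans n.lt_succ_self)]

/-! ### Generating and balanced line systems -/

/-- The idempotents and arrows generate the algebra. -/
def Generates (k : Type*) [Field k] [Algebra k R] : Prop :=
  Algebra.adjoin k (Set.range S.e ∪ Set.range fun p : ι × V => S.arr p.1 p.2) = ⊤

variable {S} in
theorem generator_mul_path {r : R}
    (hr : r ∈ Set.range S.e ∪ Set.range fun p : ι × V => S.arr p.1 p.2) (c : ι) (x : V) (n : ℕ) :
    r * S.path c x n = 0 ∨ ∃ d m, r * S.path c x n = S.path d x m := by
  rcases hr with ⟨y, rfl⟩ | ⟨⟨d, y⟩, rfl⟩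
  · rcases eq_or_ne y ((s c)^[n] x) with rfl | h
    · exact Or.inr ⟨c, n, S.e_mul_path c x n⟩
    · exact Or.inl (S.e_mul_path_of_ne h)
  · rcases eq_or_ne y ((s c)^[n] x) with rfl | h
    · rcases eq_or_ne c d with rfl | hcd
      · exact Or.inr ⟨c, n + 1, rfl⟩
      · rcases eq_or_ne n 0 with rfl | hn
        · exact Or.inr ⟨d, 1, rfl⟩
        · exact Or.inl (S.arr_mul_path_cross hcd x hn)
    · exact Or.inl (S.arr_mul_path_of_ne h)

theorem Generates.span_path [Nonempty ι] {k : Type*} [Field k] [Algebra k R] {S : LineSystem s R}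
    (hS : S.Generates k) :
    Submodule.span k {r | ∃ c x n, r = S.path c x n} = ⊤ := by
  rw [eq_top_iff, ← Algebra.top_toSubmodule, ← hS, Algebra.adjoin_eq_span, Submodule.span_le]
  intro m hm
  have word_mul_e (x : V) : m * S.e x = 0 ∨ ∃ c n, m * S.e x = S.path c x n := by
    induction hm using Submonoid.closure_induction_left with
    | one => exact Or.inr ⟨Classical.arbitrary ι, 0, one_mul _⟩
    | mul_left r hr m _ ih =>
      rw [mul_assoc]
      rcases ih with h | ⟨c, n, h⟩ <;> rw [h]
      · exact Or.inl (mul_zero r)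
      · exact generator_mul_path hr c x n
  rw [← mul_one m, ← S.complete.complete, Finset.mul_sum]
  refine sum_mem fun x _ => ?_
  rcases word_mul_e x with h | ⟨c, n, h⟩ <;> rw [h]
  · exact zero_mem _
  · exact Submodule.subset_span ⟨c, x, n, rfl⟩

/-- The closed paths running once through the orbits of a point agree. -/
def Balanced : Prop :=
  ∀ c d x, S.path c x (Function.minimalPeriod (s c) x) =
    S.path d x (Function.minimalPeriod (s d) x)

theorem Balanced.path_eq_zero [Nontrivial ι] {S : LineSystem s R} (hS : S.Balanced) (c : ι)
    {x : V} {n : ℕ} (hn : Function.minimalPeriod (s c) x < n) : S.path c x n = 0 := by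
  obtain ⟨d, hd⟩ := exists_ne c
  obtain ⟨m, rfl⟩ := Nat.exists_eq_add_of_lt hn
  have hper {b : ι} : (s b)^[Function.minimalPeriod (s b) x] x = x :=
    Function.iterate_minimalPeriod
  have zero : S.path c x (Function.minimalPeriod (s c) x + 1) = 0 := by
    have hcross := S.arr_mul_path_cross hd x (minimalPeriod_perm_pos (s d) x).ne'
    rwa [hper, ← hS c d x, ← congrArg (S.arr c) hper, ← path_succ] at hcross
  rw [add_assoc, add_comm m 1, ← add_assoc, path_add, zero, mul_zero]

end LineSystem

/-! ### The pedigree algebra -/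

namespace Pedigree

variable (k : Type w) [Field k] (L : Pedigree)

theorem mkAlgHom_arrow_mul_arrow {c d : PedigreeStep} (hcd : c ≠ d) {x : L.Point}
    (h : L.Inner c x) (h' : L.Inner d (L.next c x)) :
    RingQuot.mkAlgHom k (L.Rel k) (PathAlgebra.arrow k (innerArrow d _ h')) *
      RingQuot.mkAlgHom k (L.Rel k) (PathAlgebra.arrow k (innerArrow c x h)) = 0 := by
  cases c <;> cases d
  · exact absurd rfl hcd
  · have hα : L.next .alpha x = _ := climb_of_mem h
    have hβ : L.next .alpha x = _ := (climb_next_betaInv _).symm.trans (climb_of_mem h')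
    exact nomatch congrArg Subtype.val (hα.symm.trans hβ)
  · simpa [PathAlgebra.path, innerArrow] using
      RingQuot.mkAlgHom_rel k (Rel.alpha_beta (k := k) (L.next .betaInv x) h h')
  · exact absurd rfl hcd

open scoped Classical in
/-- The idempotents and arrows of the pedigree algebra; the missing arrow from the last to the
first point of a line is replaced by zero. -/
def lineSystem : LineSystem L.next (L.algebra k) where
  e x := RingQuot.mkAlgHom k (L.Rel k) (PathAlgebra.vertex k x)
  arr c x := if h : L.Inner c x then
    RingQuot.mkAlgHom k (L.Rel k) (PathAlgebra.arrow k (innerArrow c x h)) else 0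
  complete := (PathAlgebra.completeOrthogonalIdempotents_vertex k).map
    (RingQuot.mkAlgHom k (L.Rel k)).toRingHom
  target c x := by
    split_ifs with h
    · rw [← innerArrow_right c x h, ← map_mul, PathAlgebra.vertex_mul_arrow]
    · rw [mul_zero]
  source c x := by
    split_ifs with h
    · conv_lhs => enter [2, 2, 2]; rw [← innerArrow_left c x h]
      rw [← map_mul, PathAlgebra.arrow_mul_vertex]
    · rw [zero_mul]
  cross hcd x := by
    split_ifs with h' h
    · exact mkAlgHom_arrow_mul_arrow k L hcd h h'
    all_goals simp

variable {L}

theorem lineSystem_arr {c : PedigreeStep} {x : L.Point} (h : L.Inner c x) :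
    (L.lineSystem k).arr c x =
      RingQuot.mkAlgHom k (L.Rel k) (PathAlgebra.arrow k (innerArrow c x h)) := dif_pos h

theorem lineSystem_arr_of_not {c : PedigreeStep} {x : L.Point} (h : ¬ L.Inner c x) :
    (L.lineSystem k).arr c x = 0 := dif_neg h

variable (L) in
theorem generates_lineSystem : (L.lineSystem k).Generates k := by
  rw [LineSystem.Generates, eq_top_iff, ← PathAlgebra.adjoin_image_eq_top]
  apply Algebra.adjoin_mono
  rintro _ (⟨x, rfl⟩ | ⟨a, rfl⟩)
  · exact Or.inl ⟨x, rfl⟩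
  · obtain ⟨c, x, h, rfl⟩ := exists_eq_innerArrow a
    exact Or.inr ⟨(c, x), lineSystem_arr k h⟩

theorem lineSystem_path_eq_zero {c : PedigreeStep} {x : L.Point} {i n : ℕ} (hi : i < n)
    (h : ¬ L.Inner c ((L.next c)^[i] x)) : (L.lineSystem k).path c x n = 0 := by
  obtain ⟨m, rfl⟩ := Nat.exists_eq_add_of_lt hi
  rw [add_assoc, add_comm m 1, ← add_assoc, LineSystem.path_add, LineSystem.path_succ,
    lineSystem_arr_of_not k h, zero_mul, mul_zero]

section Lift

variable {k} {R : Type*} [Ring R] [Algebra k R] (S : LineSystem L.next R)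

/-- The image of an arrow of the pedigree in a line system. -/
def arrowImage (a : Quiver.Total L.Point) : R :=
  match a with
  | ⟨_, _, Arrow.alpha x _⟩ => S.arr .alpha x
  | ⟨_, _, Arrow.beta _ h⟩ => S.arr .betaInv ⟨_, h⟩

theorem arrowImage_innerArrow (c : PedigreeStep) (x : L.Point) (h : L.Inner c x) :
    arrowImage S (innerArrow c x h) = S.arr c x := by
  cases c
  · rfl
  · exact congrArg (S.arr .betaInv) (innerArrow_left .betaInv x h)

theorem e_right_mul_arrowImage (a : Quiver.Total L.Point) :
    S.e a.right * arrowImage S a = arrowImage S a := by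
  obtain ⟨c, x, h, rfl⟩ := exists_eq_innerArrow a
  rw [arrowImage_innerArrow, innerArrow_right, S.target]

theorem arrowImage_mul_e_left (a : Quiver.Total L.Point) :
    arrowImage S a * S.e a.left = arrowImage S a := by
  obtain ⟨c, x, h, rfl⟩ := exists_eq_innerArrow a
  rw [arrowImage_innerArrow, innerArrow_left, S.source]

variable (k) in
/-- The homomorphism from the pedigree algebra given by a line system. -/
def lift : L.algebra k →ₐ[k] R :=
  RingQuot.liftAlgHom k ⟨PathAlgebra.lift S.complete (e_right_mul_arrowImage S)
    (arrowImage_mul_e_left S), by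
      rintro _ _ ⟨x, h', h''⟩
      have h := S.cross (c := .betaInv) (d := .alpha) (by simp) ⟨_, h'⟩
      rw [next_betaInv_of_mem] at h
      simpa [PathAlgebra.path, arrowImage] using h⟩

@[simp]
theorem lift_e (x : L.Point) : lift k S ((L.lineSystem k).e x) = S.e x := by
  simp [lift, lineSystem]

theorem lift_arr {c : PedigreeStep} {x : L.Point} (h : L.Inner c x) :
    lift k S ((L.lineSystem k).arr c x) = S.arr c x := by
  simp [lift, lineSystem_arr k h, arrowImage_innerArrow]

theorem lift_path {c : PedigreeStep} {x : L.Point} {n : ℕ}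
    (h : ∀ i < n, L.Inner c ((L.next c)^[i] x)) :
    lift k S ((L.lineSystem k).path c x n) = S.path c x n :=
  LineSystem.map_path (lift_e S x) fun i hi => lift_arr S (h i hi)

end Lift

end Pedigree

/-! ### Matrix representations -/

section Matrix

variable {ι V : Type*} [Fintype V] [DecidableEq ι] [DecidableEq V] (s : ι → Equiv.Perm V)
  (R : Type*) [Ring R]

/-- The line system of elementary matrices in which only the arrows of kind `c` survive. -/
def matrixSystem (c : ι) : LineSystem s (Matrix V V R) where
  e x := Matrix.single x x 1
  arr d x := if d = c then Matrix.single (s c x) x 1 else 0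
  complete :=
    { idem := fun x => by simp [IsIdempotentElem]
      ortho := fun x y h => by simp [h]
      complete := Matrix.sum_single_one }
  target d x := by
    split_ifs with h
    · simp [h]
    · simp
  source d x := by split_ifs <;> simp
  cross {d d'} h x := by
    by_cases hd : d = c
    · rw [if_neg (hd ▸ h.symm), zero_mul]
    · rw [if_neg hd, mul_zero]

variable {s R}

theorem matrixSystem_path (c : ι) (x : V) (n : ℕ) :
    (matrixSystem s R c).path c x n = Matrix.single ((s c)^[n] x) x 1 := by
  induction n with
  | zero => rfl
  | succ n ih =>
    rw [LineSystem.path_succ, ih, Function.iterate_succ_apply']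
    simp [matrixSystem]

theorem matrixSystem_path_of_ne {c d : ι} (hcd : d ≠ c) (x : V) {n : ℕ} (hn : n ≠ 0) :
    (matrixSystem s R c).path d x n = 0 := by
  obtain ⟨n, rfl⟩ := Nat.exists_eq_succ_of_ne_zero hn
  simp [LineSystem.path_succ, matrixSystem, hcd]

end Matrix

namespace Pedigree

variable (k : Type w) [Field k] (L : Pedigree)

/-- The representation of the pedigree algebra on the lines of kind `c`. -/
def matrixRep (c : PedigreeStep) : L.algebra k →ₐ[k] Matrix L.Point L.Point k :=
  lift k (matrixSystem L.next k c)

variable {L}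

theorem matrixRep_e (c : PedigreeStep) (x : L.Point) :
    L.matrixRep k c ((L.lineSystem k).e x) = Matrix.single x x 1 := lift_e _ x

theorem matrixRep_path {c : PedigreeStep} {x : L.Point} {n : ℕ}
    (h : ∀ i < n, L.Inner c ((L.next c)^[i] x)) :
    L.matrixRep k c ((L.lineSystem k).path c x n) = Matrix.single ((L.next c)^[n] x) x 1 := by
  rw [matrixRep, lift_path _ h, matrixSystem_path]

theorem matrixRep_path_of_ne {c d : PedigreeStep} (hcd : d ≠ c) {x : L.Point} {n : ℕ}
    (hn : n ≠ 0) (h : ∀ i < n, L.Inner d ((L.next d)^[i] x)) :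
    L.matrixRep k c ((L.lineSystem k).path d x n) = 0 := by
  rw [matrixRep, lift_path _ h, matrixSystem_path_of_ne hcd x hn]

theorem matrixRep_arr_of_ne {c d : PedigreeStep} (hcd : d ≠ c) {x : L.Point}
    (h : L.Inner d x) : L.matrixRep k c ((L.lineSystem k).arr d x) = 0 := by
  rw [← LineSystem.path_one, matrixRep_path_of_ne k hcd one_ne_zero]
  simpa using h

/-- The functional on the pedigree algebra taking the entry at `(x, y)` of the representation on
the lines of kind `c`; if a path leads from `y` to `x` in such a line, it is dual to that path. -/
def entry (c : PedigreeStep) (x y : L.Point) : DualBimodule k (L.algebra k) :=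
  Matrix.entryLinearMap k k x y ∘ₗ (L.matrixRep k c).toLinearMap

theorem entry_apply (c : PedigreeStep) (x y : L.Point) (a : L.algebra k) :
    entry k c x y a = L.matrixRep k c a x y := rfl

variable {k}

theorem smul_entry {c : PedigreeStep} {a : L.algebra k} {y z : L.Point}
    (ha : L.matrixRep k c a = Matrix.single z y 1) (x : L.Point) :
    a • entry k c x y = entry k c x z :=
  DualBimodule.ext' fun b => by
    simp [DualBimodule.left_smul_apply, entry_apply, ha]

theorem op_smul_entry {c : PedigreeStep} {a : L.algebra k} {x z : L.Point}
    (ha : L.matrixRep k c a = Matrix.single x z 1) (y : L.Point) :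
    MulOpposite.op a • entry k c x y = entry k c z y :=
  DualBimodule.ext' fun b => by
    simp [DualBimodule.right_smul_apply, entry_apply, ha]

theorem smul_entry_of_eq_zero {c : PedigreeStep} {a : L.algebra k}
    (ha : L.matrixRep k c a = 0) (x y : L.Point) : a • entry k c x y = 0 :=
  DualBimodule.ext' fun b => by
    simp [DualBimodule.left_smul_apply, DualBimodule.zero_apply', entry_apply, ha]

theorem op_smul_entry_of_eq_zero {c : PedigreeStep} {a : L.algebra k}
    (ha : L.matrixRep k c a = 0) (x y : L.Point) : MulOpposite.op a • entry k c x y = 0 :=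
  DualBimodule.ext' fun b => by
    simp [DualBimodule.right_smul_apply, DualBimodule.zero_apply', entry_apply, ha]

end Pedigree

/-! ### The line system of the trivial extension -/

namespace Pedigree

open Function (minimalPeriod iterate_minimalPeriod)
open TrivSqZeroExt (inl inr inlHom inl_mul_inl inl_mul_inr inr_mul_inl inr_mul_inr inl_zero
  inr_zero)

variable (k : Type w) [Field k]

open scoped Classical in
/-- The idempotents and arrows of the trivial extension. The arrow from the last to the first point
of a line is the functional dual to the path running through the line. -/
def trivExtSystem (L : Pedigree) : LineSystem L.next (TrivialExtension k (L.algebra k)) where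
  e x := inl ((L.lineSystem k).e x)
  arr c x := if L.Inner c x then inl ((L.lineSystem k).arr c x)
    else inr (entry k c x (L.next c x))
  complete := (L.lineSystem k).complete.map
    (inlHom (L.algebra k) (DualBimodule k (L.algebra k)))
  target c x := by
    split_ifs with h
    · rw [inl_mul_inl, LineSystem.target]
    · rw [inl_mul_inr, smul_entry (matrixRep_e k c _)]
  source c x := by
    split_ifs with h
    · rw [inl_mul_inl, LineSystem.source]
    · rw [inr_mul_inl, op_smul_entry (matrixRep_e k c _)]
  cross hcd x := by
    split_ifs with h' h h
    · rw [inl_mul_inl, LineSystem.cross _ hcd, inl_zero]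
    · rw [inl_mul_inr, smul_entry_of_eq_zero (matrixRep_arr_of_ne k hcd.symm h'), inr_zero]
    · rw [inr_mul_inl, op_smul_entry_of_eq_zero (matrixRep_arr_of_ne k hcd h), inr_zero]
    · rw [inr_mul_inr]

variable {L : Pedigree}

theorem trivExtSystem_arr {c : PedigreeStep} {x : L.Point} (h : L.Inner c x) :
    (L.trivExtSystem k).arr c x = inl ((L.lineSystem k).arr c x) := if_pos h

theorem trivExtSystem_arr_of_not {c : PedigreeStep} {x : L.Point} (h : ¬ L.Inner c x) :
    (L.trivExtSystem k).arr c x = inr (entry k c x (L.next c x)) := if_neg h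

theorem trivExtSystem_path {c : PedigreeStep} {x : L.Point} {n : ℕ}
    (h : ∀ i < n, L.Inner c ((L.next c)^[i] x)) :
    (L.trivExtSystem k).path c x n = inl ((L.lineSystem k).path c x n) :=
  (LineSystem.map_path (f := inlHom (L.algebra k) (DualBimodule k (L.algebra k))) rfl
    fun i hi => (trivExtSystem_arr k (h i hi)).symm).symm

theorem trivExtSystem_path_of_not {c : PedigreeStep} {x : L.Point} {i n : ℕ} (hi : i < n)
    (hi' : ¬ L.Inner c ((L.next c)^[i] x))
    (h : ∀ j < n, j ≠ i → L.Inner c ((L.next c)^[j] x)) :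
    (L.trivExtSystem k).path c x n = inr (entry k c x ((L.next c)^[n] x)) := by
  obtain ⟨m, rfl⟩ := Nat.exists_eq_add_of_lt hi
  have before : ∀ j < i, L.Inner c ((L.next c)^[j] x) := fun j hj => h j (hj.trans hi) hj.ne
  have after : ∀ j < m, L.Inner c ((L.next c)^[j] ((L.next c)^[i + 1] x)) := by
    intro j hj
    rw [← Function.iterate_add_apply]
    exact h _ (by omega) (by omega)
  rw [add_assoc, add_comm m 1, ← add_assoc, LineSystem.path_add, LineSystem.path_succ,
    trivExtSystem_path k before, trivExtSystem_path k after, trivExtSystem_arr_of_not k hi',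
    inr_mul_inl, op_smul_entry (matrixRep_path k before), inl_mul_inr,
    ← Function.iterate_succ_apply' (L.next c), smul_entry (matrixRep_path k after),
    ← Function.iterate_add_apply, add_comm m]

theorem exists_lt_minimalPeriod_not_inner (c : PedigreeStep) (x : L.Point) :
    ∃ i < minimalPeriod (L.next c) x, ¬ L.Inner c ((L.next c)^[i] x) ∧
      ∀ j < minimalPeriod (L.next c) x, j ≠ i → L.Inner c ((L.next c)^[j] x) := by
  have sameCycle_iterate (n : ℕ) : (L.next c).SameCycle x ((L.next c)^[n] x) := by
    rw [← Equiv.Perm.coe_pow, Equiv.Perm.sameCycle_pow_right]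
  obtain ⟨y, hy, h⟩ := exists_sameCycle_not_inner c x
  obtain ⟨n, rfl⟩ := hy.exists_nat_pow_eq
  rw [Equiv.Perm.coe_pow, ← Function.iterate_mod_minimalPeriod_eq] at h
  have hlt := Nat.mod_lt n (minimalPeriod_perm_pos (L.next c) x)
  refine ⟨_, hlt, h, fun j hj => not_imp_comm.1 fun hj' => ?_⟩
  exact (Function.iterate_eq_iterate_iff_of_lt_minimalPeriod hj hlt).1
    (eq_of_not_inner ((sameCycle_iterate j).symm.trans (sameCycle_iterate _)) hj' h)

theorem trivExtSystem_path_complement {c : PedigreeStep} {x : L.Point} {n : ℕ}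
    (h : ∀ i < n, L.Inner c ((L.next c)^[i] x)) :
    (L.trivExtSystem k).path c ((L.next c)^[n] x) (minimalPeriod (L.next c) x - n) =
      inr (entry k c ((L.next c)^[n] x) x) := by
  obtain ⟨i, hi, hi', hinner⟩ := exists_lt_minimalPeriod_not_inner c x
  obtain ⟨m, rfl⟩ := Nat.exists_eq_add_of_le (not_lt.1 fun hlt : i < n => hi' (h i hlt))
  have iterate_add (j : ℕ) : (L.next c)^[j] ((L.next c)^[n] x) = (L.next c)^[n + j] x := by
    rw [← Function.iterate_add_apply, add_comm]
  rw [trivExtSystem_path_of_not k (i := m) (by omega) (by rwa [iterate_add]), iterate_add,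
    Nat.add_sub_cancel' (by omega), iterate_minimalPeriod]
  intro j hj hjm
  rw [iterate_add]
  exact hinner (n + j) (by omega) (by omega)

/-! ### Paths in a pedigree -/

/-- The paths in a pedigree that are not zero in the pedigree algebra: each runs along one line.
The path of length zero at a point is counted once, as a path of kind `alpha`. -/
structure InnerPath (L : Pedigree) where
  /-- The kind of the line. -/
  kind : PedigreeStep
  /-- The first point. -/
  start : L.Point
  /-- The number of arrows. -/
  length : ℕ
  inner : ∀ i < length, L.Inner kind ((L.next kind)^[i] start)
  kind_eq : length = 0 → kind = .alpha

namespace InnerPath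

/-- The last point of the path. -/
def target (p : InnerPath L) : L.Point := (L.next p.kind)^[p.length] p.start

theorem length_lt (p : InnerPath L) : p.length < minimalPeriod (L.next p.kind) p.start := by
  obtain ⟨i, hi, hi', -⟩ := exists_lt_minimalPeriod_not_inner p.kind p.start
  exact (not_lt.1 fun h => hi' (p.inner i h)).trans_lt hi

theorem target_ne_start {p : InnerPath L} (h : p.length ≠ 0) : p.target ≠ p.start :=
  fun heq => Function.not_isPeriodicPt_of_pos_of_lt_minimalPeriod h p.length_lt heq

theorem eq_of_target_eq {p q : InnerPath L} (hkind : p.kind = q.kind) (hstart : p.start = q.start)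
    (htarget : p.target = q.target) : p = q := by
  rcases p with ⟨c, x, m, hm, hm'⟩
  rcases q with ⟨d, y, n, hn, hn'⟩
  obtain rfl : c = d := hkind
  obtain rfl : x = y := hstart
  obtain rfl := (Function.iterate_eq_iterate_iff_of_lt_minimalPeriod
    (length_lt ⟨c, x, m, hm, hm'⟩) (length_lt ⟨c, x, n, hn, hn'⟩)).1 htarget
  rfl

instance : Finite PedigreeStep :=
  Finite.of_injective (fun c => decide (c = .alpha)) fun c d => by cases c <;> cases d <;> simp

instance : Finite (InnerPath L) :=
  Finite.of_injective (fun p => (p.kind, p.start, p.target)) fun _ _ h => by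
    obtain ⟨hkind, hstart, htarget⟩ := by simpa only [Prod.mk.injEq] using h
    exact eq_of_target_eq hkind hstart htarget

/-- The path as an element of the pedigree algebra. -/
def toAlgebra (p : InnerPath L) : L.algebra k := (L.lineSystem k).path p.kind p.start p.length

/-- The functional on the pedigree algebra that is dual to the path. -/
def dual (p : InnerPath L) : DualBimodule k (L.algebra k) := entry k p.kind p.target p.start

theorem dual_apply_self (p : InnerPath L) : p.dual k (p.toAlgebra k) = 1 := by
  rw [dual, toAlgebra, entry_apply, matrixRep_path k p.inner]
  exact Matrix.single_apply_same ..

theorem dual_apply_of_ne {p q : InnerPath L} (h : p ≠ q) : p.dual k (q.toAlgebra k) = 0 := by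
  rw [dual, toAlgebra, entry_apply]
  by_cases hkind : q.kind = p.kind
  · rw [← hkind, matrixRep_path k q.inner, Matrix.single_apply_of_ne]
    exact fun heq => h (eq_of_target_eq hkind.symm heq.2.symm heq.1.symm)
  by_cases hq : q.length = 0
  · rw [hq, LineSystem.path_zero, matrixRep_e, Matrix.single_apply_of_ne]
    refine fun heq => target_ne_start (fun hp => hkind ?_) (heq.1.symm.trans heq.2)
    rw [p.kind_eq hp, q.kind_eq hq]
  · rw [matrixRep_path_of_ne k hkind hq q.inner, Matrix.zero_apply]

/-- The trivial path at a point. -/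
def nil (x : L.Point) : InnerPath L := ⟨.alpha, x, 0, nofun, fun _ => rfl⟩

theorem exists_path_eq {c : PedigreeStep} {x : L.Point} {n : ℕ}
    (h : ∀ i < n, L.Inner c ((L.next c)^[i] x)) :
    ∃ p : InnerPath L, (L.lineSystem k).path c x n = p.toAlgebra k := by
  by_cases hn : n = 0
  · exact ⟨nil x, by rw [hn]; rfl⟩
  · exact ⟨⟨c, x, n, h, fun h0 => absurd h0 hn⟩, rfl⟩

theorem span_toAlgebra :
    Submodule.span k (Set.range (toAlgebra k : InnerPath L → L.algebra k)) = ⊤ := by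
  have : Nonempty PedigreeStep := ⟨.alpha⟩
  rw [eq_top_iff, ← (generates_lineSystem k L).span_path, Submodule.span_le]
  rintro _ ⟨c, x, n, rfl⟩
  by_cases h : ∀ i < n, L.Inner c ((L.next c)^[i] x)
  · obtain ⟨p, hp⟩ := exists_path_eq k h
    exact hp ▸ Submodule.subset_span ⟨p, rfl⟩
  · push Not at h
    obtain ⟨i, hi, hi'⟩ := h
    rw [lineSystem_path_eq_zero k hi hi']
    exact zero_mem _

theorem entry_self_toAlgebra {p : InnerPath L} (h : p.length ≠ 0) (c : PedigreeStep)
    (x : L.Point) : entry k c x x (p.toAlgebra k) = 0 := by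
  rw [toAlgebra, entry_apply]
  by_cases hkind : p.kind = c
  · rw [← hkind, matrixRep_path k p.inner, Matrix.single_apply_of_ne]
    exact fun heq => target_ne_start h (heq.1.trans heq.2.symm)
  · rw [matrixRep_path_of_ne k hkind h p.inner, Matrix.zero_apply]

end InnerPath

theorem entry_self_eq (c d : PedigreeStep) (x : L.Point) : entry k c x x = entry k d x x := by
  refine LinearMap.ext_on_range (InnerPath.span_toAlgebra k) fun p => ?_
  by_cases hp : p.length = 0
  · change L.matrixRep k c (p.toAlgebra k) x x = L.matrixRep k d (p.toAlgebra k) x x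
    rw [InnerPath.toAlgebra, hp, LineSystem.path_zero, matrixRep_e, matrixRep_e]
  · exact (InnerPath.entry_self_toAlgebra k hp c x).trans
      (InnerPath.entry_self_toAlgebra k hp d x).symm

theorem balanced_trivExtSystem : (L.trivExtSystem k).Balanced := by
  have path_minimalPeriod (c : PedigreeStep) (x : L.Point) :
      (L.trivExtSystem k).path c x (minimalPeriod (L.next c) x) = inr (entry k c x x) :=
    trivExtSystem_path_complement k (n := 0) nofun
  intro c d x
  rw [path_minimalPeriod, path_minimalPeriod, entry_self_eq]

end Pedigree

/-! ### Bases of a trivial extension -/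

theorem bijective_of_span_of_basis {K M N ι F : Type*} [Semiring K] [AddCommMonoid M]
    [AddCommMonoid N] [Module K M] [Module K N] [FunLike F M N] [LinearMapClass F K M N] {f : F}
    {v : ι → M} (hv : Submodule.span K (Set.range v) = ⊤) (b : Module.Basis ι K N)
    (h : ∀ i, f (v i) = b i) : Function.Bijective f := by
  have hsurj : Function.Surjective (b.constr ℕ v) := by
    rw [← LinearMap.range_eq_top, b.constr_range, hv]
  have hleft : Function.LeftInverse f (b.constr ℕ v) := by
    refine DFunLike.congr_fun
      (b.ext (f₁ := (f : M →ₗ[K] N) ∘ₗ b.constr ℕ v) (f₂ := .id) fun i => ?_)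
    simp [h]
  exact ⟨(hleft.rightInverse_of_surjective hsurj).injective, hleft.surjective⟩

namespace TrivialExtension

variable {k : Type w} [Field k] {A : Type u} [Ring A] [Algebra k A] {ι : Type*} [Finite ι]

open TrivSqZeroExt (inl inr)

variable (k A) in
/-- The trivial extension as a direct sum. -/
def equivProd : TrivialExtension k A ≃ₗ[k] A × DualBimodule k A where
  toFun t := (t.fst, t.snd)
  invFun p := inl p.1 + inr p.2
  left_inv := TrivSqZeroExt.inl_fst_add_inr_snd_eq
  right_inv p := by simp
  map_add' _ _ := rfl
  map_smul' _ _ := rfl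

open scoped Classical in
/-- The basis of the trivial extension formed by a basis of the algebra and its dual basis. -/
def basis (b : Module.Basis ι k A) : Module.Basis (ι ⊕ ι) k (TrivialExtension k A) :=
  (b.prod (show Module.Basis ι k (DualBimodule k A) from b.dualBasis)).map (equivProd k A).symm

theorem basis_inl (b : Module.Basis ι k A) (i : ι) : basis b (.inl i) = inl (b i) := by
  rw [basis, Module.Basis.map_apply, LinearEquiv.symm_apply_eq]
  exact Prod.ext (b.prod_apply_inl_fst _ i) (b.prod_apply_inl_snd _ i)

theorem basis_inr {b : Module.Basis ι k A} {i : ι} {f : DualBimodule k A} (hf : f (b i) = 1)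
    (hf' : ∀ j ≠ i, f (b j) = 0) : basis b (.inr i) = inr f := by
  classical
  have hdual : (show DualBimodule k A from b.dualBasis i) = f := b.ext fun j => by
    rcases eq_or_ne j i with rfl | hj
    · rw [b.dualBasis_apply_self, if_pos rfl]
      exact hf.symm
    · rw [b.dualBasis_apply_self, if_neg hj]
      exact (hf' j hj).symm
  rw [basis, Module.Basis.map_apply, LinearEquiv.symm_apply_eq, ← hdual]
  exact Prod.ext (b.prod_apply_inr_fst _ i) (b.prod_apply_inr_snd _ i)

theorem bijective_of_dual {R : Type*} [Ring R] [Algebra k R] {v : ι → A} {f : ι → DualBimodule k A}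
    (hv : Submodule.span k (Set.range v) = ⊤) (hself : ∀ i, f i (v i) = 1)
    (hne : ∀ {i j}, i ≠ j → f i (v j) = 0) {r : ι ⊕ ι → R}
    (hr : Submodule.span k (Set.range r) = ⊤) {φ : R →ₐ[k] TrivialExtension k A}
    (hinl : ∀ i, φ (r (.inl i)) = inl (v i)) (hinr : ∀ i, φ (r (.inr i)) = inr (f i)) :
    Function.Bijective φ := by
  have hli : LinearIndependent k v :=
    .of_pairwise_dual_eq_zero_one v (fun i => show Module.Dual k A from f i) (fun _ _ => hne) hself
  have hb (i) : Module.Basis.mk hli hv.ge i = v i := Module.Basis.mk_apply ..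
  refine bijective_of_span_of_basis hr (basis (.mk hli hv.ge)) ?_
  rintro (i | i)
  · rw [hinl, basis_inl, hb]
  · rw [hinr, basis_inr]
    · rw [hb, hself]
    · exact fun j hj => by rw [hb, hne hj.symm]

end TrivialExtension

namespace Pedigree

open Function (minimalPeriod iterate_minimalPeriod)

variable {k : Type w} [Field k] {L : Pedigree} {R : Type*} [Ring R] [Algebra k R]
  {S : LineSystem L.next R}

variable (S) in
/-- The elements of a line system that belong to the paths of a pedigree and to their complements
in the closed paths running once through a line. -/
def pathOrComplement : InnerPath L ⊕ InnerPath L → R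
  | .inl p => S.path p.kind p.start p.length
  | .inr p => S.path p.kind p.target (minimalPeriod (L.next p.kind) p.start - p.length)

theorem exists_pathOrComplement_eq (hS : S.Balanced) {c : PedigreeStep} {x : L.Point} {n : ℕ}
    (hn : n ≤ minimalPeriod (L.next c) x) : ∃ p, pathOrComplement S p = S.path c x n := by
  obtain rfl | hn0 := eq_or_ne n 0
  · exact ⟨.inl (.nil x), rfl⟩
  by_cases h : ∀ i < n, L.Inner c ((L.next c)^[i] x)
  · exact ⟨.inl ⟨c, x, n, h, fun h0 => absurd h0 hn0⟩, rfl⟩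
  obtain rfl | hlt := hn.eq_or_lt
  · exact ⟨.inr (.nil x), hS .alpha c x⟩
  push Not at h
  obtain ⟨i, hi, hi'⟩ := h
  obtain ⟨j, hj, hj', hinner⟩ := exists_lt_minimalPeriod_not_inner c x
  obtain rfl : i = j := not_imp_comm.1 (hinner i (hi.trans hlt)) hi'
  obtain ⟨m, hm⟩ := Nat.exists_eq_add_of_le hn
  have iterate_add (a : ℕ) : (L.next c)^[a] ((L.next c)^[n] x) = (L.next c)^[n + a] x := by
    rw [← Function.iterate_add_apply, add_comm]
  refine ⟨.inr ⟨c, (L.next c)^[n] x, m, fun a ha => ?_, by omega⟩, ?_⟩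
  · rw [iterate_add]
    exact hinner (n + a) (by omega) (by omega)
  · change S.path c ((L.next c)^[m] _) (minimalPeriod (L.next c) ((L.next c)^[n] x) - m) = _
    rw [iterate_add, ← hm, iterate_minimalPeriod, Function.minimalPeriod_apply_iterate
      ((L.next c).injective.mem_periodicPts x), hm, Nat.add_sub_cancel_right]

instance : Nontrivial PedigreeStep := ⟨.alpha, .betaInv, nofun⟩

theorem span_pathOrComplement (hS : S.Balanced) (hS' : S.Generates k) :
    Submodule.span k (Set.range (pathOrComplement S)) = ⊤ := by
  rw [eq_top_iff, ← hS'.span_path, Submodule.span_le]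
  rintro _ ⟨c, x, n, rfl⟩
  rcases le_or_gt n (minimalPeriod (L.next c) x) with hn | hn
  · obtain ⟨p, hp⟩ := exists_pathOrComplement_eq hS hn
    exact hp ▸ Submodule.subset_span ⟨p, rfl⟩
  · rw [hS.path_eq_zero c hn]
    exact zero_mem _

theorem bijective_of_balanced (hS : S.Balanced) (hS' : S.Generates k)
    {f : R →ₐ[k] TrivialExtension k (L.algebra k)}
    (he : ∀ x, f (S.e x) = (L.trivExtSystem k).e x)
    (harr : ∀ c x, f (S.arr c x) = (L.trivExtSystem k).arr c x) : Function.Bijective f := by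
  have map_path (c : PedigreeStep) (x : L.Point) (n : ℕ) :
      f (S.path c x n) = (L.trivExtSystem k).path c x n :=
    LineSystem.map_path (he x) fun i _ => harr c _
  exact TrivialExtension.bijective_of_dual (InnerPath.span_toAlgebra k)
    (InnerPath.dual_apply_self k) (InnerPath.dual_apply_of_ne k) (span_pathOrComplement hS hS')
    (fun p => (map_path ..).trans (trivExtSystem_path k p.inner))
    fun p => (map_path ..).trans (trivExtSystem_path_complement k p.inner)

end Pedigree

/-! ### Cycles in quivers -/

theorem exists_coe_cons_eq_of_mem {α : Type*} {Z : Cycle α} {a : α} (ha : a ∈ Z) :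
    ∃ l : List α, Z = ↑(a :: l) := by
  induction Z using Quotient.inductionOn with
  | h l =>
    obtain ⟨l₁, l₂, rfl⟩ := List.append_of_mem (Cycle.mem_coe_iff.1 ha)
    exact ⟨l₂ ++ l₁, Cycle.coe_eq_coe.2 List.isRotated_append⟩

theorem cons_eq_map_iterate {α : Type*} {f : α → α} {a : α} {l : List α}
    (h : (a :: l).IsChain (f · = ·)) :
    a :: l = (List.range (l.length + 1)).map fun i => f^[i] a := by
  induction l generalizing a with
  | nil => rfl
  | cons b l ih =>
    obtain ⟨rfl, h⟩ := List.isChain_cons_cons.1 h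
    rw [List.length_cons, List.range_succ_eq_map, List.map_cons, List.map_map]
    exact congrArg (a :: ·) (ih h)

theorem cons_eq_map_iterate_minimalPeriod {α : Type*} {f : α → α} {a : α} {l : List α}
    (h : (a :: (l ++ [a])).IsChain (f · = ·)) (hl : (a :: l).Nodup) :
    a :: l = (List.range (Function.minimalPeriod f a)).map fun i => f^[i] a := by
  have hmap := cons_eq_map_iterate h
  rw [List.length_append, List.length_singleton, List.range_succ, List.map_append,
    ← List.cons_append] at hmap
  obtain ⟨hmap, hper⟩ := List.append_inj' hmap rfl
  obtain hper : a = f^[l.length + 1] a := List.singleton_inj.1 hper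
  have hle := Function.IsPeriodicPt.minimalPeriod_le l.length.succ_pos hper.symm
  have hpos := Function.IsPeriodicPt.minimalPeriod_pos l.length.succ_pos hper.symm
  suffices Function.minimalPeriod f a = l.length + 1 by rwa [this]
  refine hle.antisymm (not_lt.1 fun hlt => hpos.ne' ?_)
  rw [hmap] at hl
  exact List.inj_on_of_nodup_map hl (List.mem_range.2 hlt) (List.mem_range.2 l.length.succ_pos)
    Function.iterate_minimalPeriod

namespace IsQuiverCycle

variable {V : Type u} [Quiver.{v} V] {Z : Cycle (Quiver.Total V)}

theorem eq_of_left_eq (hZ : IsQuiverCycle Z) {a b : Quiver.Total V} (ha : a ∈ Z) (hb : b ∈ Z)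
    (h : a.left = b.left) : a = b := by
  induction Z using Quotient.inductionOn with
  | h l => exact List.inj_on_of_nodup_map (Cycle.nodup_coe_iff.1 hZ.nodup) ha hb h

theorem cons_eq_map_iterate {f : Quiver.Total V → Quiver.Total V}
    (hf : ∀ a, (f a).left = a.right) {a : Quiver.Total V} {l : List (Quiver.Total V)}
    (hZ : IsQuiverCycle (↑(a :: l) : Cycle (Quiver.Total V)))
    (hmem : ∀ b ∈ (↑(a :: l) : Cycle (Quiver.Total V)), f b ∈ (↑(a :: l) : Cycle _)) :
    a :: l = (List.range (Function.minimalPeriod f a)).map fun i => f^[i] a := by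
  have hnodup := Cycle.nodup_coe_iff.1 hZ.nodup
  refine cons_eq_map_iterate_minimalPeriod ?_ (hnodup.of_map _)
  refine ((Cycle.chain_coe_cons _ _ _).1 hZ.chain).imp_of_mem_imp fun b d hb hd hbd => ?_
  have mem_cycle {b} (hb : b ∈ a :: (l ++ [a])) : b ∈ (↑(a :: l) : Cycle (Quiver.Total V)) := by
    simpa [or_comm, or_left_comm] using hb
  exact hZ.eq_of_left_eq (hmem b (mem_cycle hb)) (mem_cycle hd) ((hf b).trans hbd)

end IsQuiverCycle

/-! ### Quivers whose cycles are the cycles of permutations -/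

/-- An identification of a quiver with the quiver that has an arrow from `x` to `s c x` for each
point `x` and each index `c`, such that each cycle runs along a cycle of a single `s c`. -/
structure CyclePresentation {ι P : Type*} (s : ι → Equiv.Perm P) (V : Type u) [Quiver.{v} V] where
  /-- The identification of the points. -/
  point : P ≃ V
  /-- The identification of the arrows. -/
  arrow : ι × P ≃ Quiver.Total V
  left : ∀ c x, (arrow (c, x)).left = point x
  right : ∀ c x, (arrow (c, x)).right = point (s c x)
  closed : ∀ Z : Cycle (Quiver.Total V), IsQuiverCycle Z → ∀ c x, arrow (c, x) ∈ Z →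
    arrow (c, s c x) ∈ Z

namespace CyclePresentation

open Function (minimalPeriod iterate_minimalPeriod)

section Cycles

variable {ι P : Type*} {s : ι → Equiv.Perm P} {V : Type u} [Quiver.{v} V]
  (m : CyclePresentation s V)

/-- The arrow following a given arrow on its line. -/
def nextArrow (a : Quiver.Total V) : Quiver.Total V :=
  m.arrow ((m.arrow.symm a).1, s (m.arrow.symm a).1 (m.arrow.symm a).2)

theorem nextArrow_arrow (c : ι) (x : P) : m.nextArrow (m.arrow (c, x)) = m.arrow (c, s c x) := by
  simp [nextArrow]

theorem iterate_nextArrow (c : ι) (x : P) (n : ℕ) :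
    m.nextArrow^[n] (m.arrow (c, x)) = m.arrow (c, (s c)^[n] x) :=
  (Function.Semiconj.iterate_right (f := fun y => m.arrow (c, y))
    (fun y => (m.nextArrow_arrow c y).symm) n x).symm

theorem minimalPeriod_nextArrow (c : ι) (x : P) :
    minimalPeriod m.nextArrow (m.arrow (c, x)) = minimalPeriod (s c) x := by
  refine Function.minimalPeriod_eq_minimalPeriod_iff.2 fun n => ?_
  simp [Function.IsPeriodicPt, Function.IsFixedPt, iterate_nextArrow]

theorem left_nextArrow (a : Quiver.Total V) : (m.nextArrow a).left = a.right := by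
  obtain ⟨⟨c, x⟩, rfl⟩ := m.arrow.surjective a
  rw [nextArrow_arrow, left, right]

/-- The arrows of a line, listed from a given point on. -/
def lineArrows (c : ι) (x : P) : List (Quiver.Total V) :=
  (List.range (minimalPeriod (s c) x)).map fun i => m.arrow (c, (s c)^[i] x)

theorem cons_eq_lineArrows {c : ι} {x : P} {l : List (Quiver.Total V)}
    (h : IsQuiverCycle (↑(m.arrow (c, x) :: l) : Cycle (Quiver.Total V))) :
    m.arrow (c, x) :: l = m.lineArrows c x := by
  rw [h.cons_eq_map_iterate m.left_nextArrow, minimalPeriod_nextArrow]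
  · simp only [iterate_nextArrow, lineArrows]
  · intro b hb
    obtain ⟨⟨d, y⟩, rfl⟩ := m.arrow.surjective b
    rw [nextArrow_arrow]
    exact m.closed _ h d y hb

theorem eq_lineArrows {c : ι} {x : P} {Z : Cycle (Quiver.Total V)} (hZ : IsQuiverCycle Z)
    (h : m.arrow (c, x) ∈ Z) : Z = m.lineArrows c x := by
  obtain ⟨l, rfl⟩ := exists_coe_cons_eq_of_mem h
  rw [m.cons_eq_lineArrows hZ]

theorem exists_lineArrows_eq_cons [Finite P] (c : ι) (x : P) :
    ∃ l, m.lineArrows c x = m.arrow (c, x) :: l := by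
  obtain ⟨n, hn⟩ := Nat.exists_eq_succ_of_ne_zero (minimalPeriod_perm_pos (s c) x).ne'
  rw [lineArrows, hn, List.range_succ_eq_map]
  exact ⟨_, rfl⟩

theorem arrow_mem_lineArrows [Finite P] (c : ι) (x : P) : m.arrow (c, x) ∈ m.lineArrows c x := by
  obtain ⟨l, hl⟩ := m.exists_lineArrows_eq_cons c x
  exact hl ▸ List.mem_cons_self

theorem isQuiverCycle_lineArrows [Finite P] (c : ι) (x : P) :
    IsQuiverCycle (m.lineArrows c x : Cycle (Quiver.Total V)) where
  ne_nil h := List.ne_nil_of_mem (m.arrow_mem_lineArrows c x) ((Cycle.coe_eq_nil _).1 h)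
  chain := by
    obtain ⟨n, hn⟩ := Nat.exists_eq_succ_of_ne_zero (minimalPeriod_perm_pos (s c) x).ne'
    have hper : (s c)^[n.succ] x = x := hn ▸ iterate_minimalPeriod
    rw [lineArrows, hn, ← Cycle.map_coe, Cycle.chain_map, Cycle.chain_range_succ]
    constructor
    · rw [m.left, m.right, ← Function.iterate_succ_apply' (s c), hper, Function.iterate_zero_apply]
    · intro i _
      rw [m.left, m.right, Function.iterate_succ_apply']
  nodup := by
    rw [Cycle.map_coe, Cycle.nodup_coe_iff, lineArrows, List.map_map]
    refine List.Nodup.map_on (fun i hi j hj hij => ?_) List.nodup_range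
    simp only [Function.comp, m.left, m.point.injective.eq_iff] at hij
    exact (Function.iterate_eq_iterate_iff_of_lt_minimalPeriod (List.mem_range.1 hi)
      (List.mem_range.1 hj)).1 hij

theorem eq_of_mem_cycle {c d : ι} {x : P} {Z : Cycle (Quiver.Total V)} (hZ : IsQuiverCycle Z)
    (h : m.arrow (c, x) ∈ Z) (h' : m.arrow (d, s c x) ∈ Z) : c = d := by
  have heq := hZ.eq_of_left_eq (m.closed Z hZ c x h) h' (by rw [m.left, m.left])
  exact (Prod.mk.inj (m.arrow.injective heq)).1

end Cycles

/-! ### The algebra of a Brauer-quiver as a line system -/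

section Algebra

variable {ι P : Type*} [Fintype P] {s : ι → Equiv.Perm P} {Q : BrauerQuiver.{u, v}}
  (m : CyclePresentation s Q.Point) (k : Type w) [Field k]

/-- The idempotents and arrows of the Brauer-quiver algebra. -/
def system : LineSystem s (Q.algebra k) where
  e x := RingQuot.mkAlgHom k (Q.Rel k) (PathAlgebra.vertex k (m.point x))
  arr c x := RingQuot.mkAlgHom k (Q.Rel k) (PathAlgebra.arrow k (m.arrow (c, x)))
  complete := ((CompleteOrthogonalIdempotents.equiv m.point).2
    (PathAlgebra.completeOrthogonalIdempotents_vertex k)).map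
    (RingQuot.mkAlgHom k (Q.Rel k)).toRingHom
  target c x := by rw [← m.right, ← map_mul, PathAlgebra.vertex_mul_arrow]
  source c x := by rw [← m.left c, ← map_mul, PathAlgebra.arrow_mul_vertex]
  cross {c d} hcd x := by
    have h := RingQuot.mkAlgHom_rel k (BrauerQuiver.Rel.zero (k := k) (m.arrow (c, x))
      (m.arrow (d, s c x)) (by rw [m.left, m.right])
      fun ⟨_, hZ, h, h'⟩ => hcd (m.eq_of_mem_cycle hZ h h'))
    simpa [PathAlgebra.path] using h

theorem path_lineArrows {R : Type*} [Ring R] [Algebra k R] {S : LineSystem s R}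
    {f : PathAlgebra k Q.Point →ₐ[k] R}
    (hf : ∀ c x, f (PathAlgebra.arrow k (m.arrow (c, x))) = S.arr c x) (c : ι) (x : P) :
    f (PathAlgebra.path k (m.lineArrows c x)) = S.path c x (minimalPeriod (s c) x) := by
  rw [S.path_eq_prod _ _ (minimalPeriod_perm_pos (s c) x).ne', PathAlgebra.path, lineArrows,
    map_list_prod, List.map_reverse, List.map_map, List.map_map]
  simp only [Function.comp_def, hf]

theorem balanced_system : (m.system k).Balanced := by
  intro c d x
  rw [← m.path_lineArrows k fun _ _ => rfl, ← m.path_lineArrows k fun _ _ => rfl]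
  have h := m.isQuiverCycle_lineArrows c x
  have h' := m.isQuiverCycle_lineArrows d x
  obtain ⟨l, hl⟩ := m.exists_lineArrows_eq_cons c x
  obtain ⟨l', hl'⟩ := m.exists_lineArrows_eq_cons d x
  rw [hl] at h ⊢
  rw [hl'] at h' ⊢
  exact RingQuot.mkAlgHom_rel k (.zeta _ _ _ _ h h' (by rw [m.left, m.left]))

theorem generates_system : (m.system k).Generates k := by
  rw [LineSystem.Generates, eq_top_iff, ← PathAlgebra.adjoin_image_eq_top]
  apply Algebra.adjoin_mono
  rintro _ (⟨x, rfl⟩ | ⟨a, rfl⟩)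
  · obtain ⟨x, rfl⟩ := m.point.surjective x
    exact Or.inl ⟨x, rfl⟩
  · obtain ⟨p, rfl⟩ := m.arrow.surjective a
    exact Or.inr ⟨p, rfl⟩

variable {k} {R : Type*} [Ring R] [Algebra k R] (S : LineSystem s R)

variable (k) in
/-- The homomorphism from the path algebra given by a line system. -/
def pathLift : PathAlgebra k Q.Point →ₐ[k] R :=
  PathAlgebra.lift (e := S.e ∘ m.point.symm)
    (f := fun a => S.arr (m.arrow.symm a).1 (m.arrow.symm a).2)
    ((CompleteOrthogonalIdempotents.equiv m.point.symm).2 S.complete)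
    (m.arrow.forall_congr_right.1 fun ⟨c, x⟩ => by simp [m.right, S.target])
    (m.arrow.forall_congr_right.1 fun ⟨c, x⟩ => by simp [m.left, S.source])

theorem pathLift_vertex (x : P) :
    m.pathLift k S (PathAlgebra.vertex k (m.point x)) = S.e x := by
  simp [pathLift]

theorem pathLift_arrow (c : ι) (x : P) :
    m.pathLift k S (PathAlgebra.arrow k (m.arrow (c, x))) = S.arr c x := by
  simp [pathLift]

variable {S}

theorem pathLift_eq_of_rel (hS : S.Balanced) {a b : PathAlgebra k Q.Point} (h : Q.Rel k a b) :
    m.pathLift k S a = m.pathLift k S b := by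
  cases h with
  | zero a b hab h =>
    obtain ⟨⟨c, x⟩, rfl⟩ := m.arrow.surjective a
    obtain ⟨⟨d, y⟩, rfl⟩ := m.arrow.surjective b
    obtain rfl : s c x = y := m.point.injective (by rw [← m.right, hab, m.left])
    have hcd : c ≠ d := by
      rintro rfl
      have hmem := m.arrow_mem_lineArrows c x
      exact h ⟨_, m.isQuiverCycle_lineArrows c x, hmem,
        m.closed _ (m.isQuiverCycle_lineArrows c x) _ _ hmem⟩
    simp [PathAlgebra.path, pathLift_arrow, S.cross hcd x]
  | zeta a a' l l' hZ hZ' hx =>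
    obtain ⟨⟨c, x⟩, rfl⟩ := m.arrow.surjective a
    obtain ⟨⟨d, y⟩, rfl⟩ := m.arrow.surjective a'
    obtain rfl : x = y := m.point.injective (by rw [← m.left c, hx, m.left])
    rw [m.cons_eq_lineArrows hZ, m.cons_eq_lineArrows hZ',
      m.path_lineArrows k (m.pathLift_arrow S), m.path_lineArrows k (m.pathLift_arrow S), hS c d x]

variable (k) in
/-- The homomorphism from the Brauer-quiver algebra given by a balanced line system. -/
def lift (hS : S.Balanced) : Q.algebra k →ₐ[k] R :=
  RingQuot.liftAlgHom k ⟨m.pathLift k S, fun _ _ h => m.pathLift_eq_of_rel hS h⟩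

theorem lift_e (hS : S.Balanced) (x : P) : m.lift k hS ((m.system k).e x) = S.e x := by
  simp [lift, system, pathLift_vertex]

theorem lift_arr (hS : S.Balanced) (c : ι) (x : P) :
    m.lift k hS ((m.system k).arr c x) = S.arr c x := by
  simp [lift, system, pathLift_arrow]

end Algebra

/-- A Brauer-quiver whose cycles are the lines of a pedigree has the same algebra as the trivial
extension of the pedigree algebra. -/
def algEquiv {L : Pedigree} {Q : BrauerQuiver.{u, v}} (m : CyclePresentation L.next Q.Point)
    (k : Type w) [Field k] : Q.algebra k ≃ₐ[k] TrivialExtension k (L.algebra k) :=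
  AlgEquiv.ofBijective (m.lift k (Pedigree.balanced_trivExtSystem k))
    (Pedigree.bijective_of_balanced (m.balanced_system k) (m.generates_system k)
      (m.lift_e _) (m.lift_arr _))

end CyclePresentation

/-! ### From cacti to Brauer-quivers -/

theorem IsQuiverCycle.exists_left_eq_right {V : Type u} [Quiver.{v} V] {Z : Cycle (Quiver.Total V)}
    (hZ : IsQuiverCycle Z) {a : Quiver.Total V} (ha : a ∈ Z) : ∃ b ∈ Z, b.left = a.right := by
  obtain ⟨l, rfl⟩ := exists_coe_cons_eq_of_mem ha
  have hchain := (Cycle.chain_coe_cons _ _ _).1 hZ.chain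
  rcases l with _ | ⟨b, l⟩
  · exact ⟨a, ha, (List.isChain_cons_cons.1 hchain).1.symm⟩
  · exact ⟨b, by simp, (List.isChain_cons_cons.1 hchain).1.symm⟩

theorem side_left_eq_of_isChain {V : Type u} [Quiver.{v} V] {κ : Type*} {side : V → κ} {p : V}
    {d : κ} (hside : ∀ a : Quiver.Total V, a.left ≠ p → a.right ≠ p → side a.right = side a.left)
    {a : Quiver.Total V} {l : List (Quiver.Total V)}
    (hchain : (a :: l).IsChain fun a b => a.right = b.left) (hl : ∀ b ∈ l, b.left ≠ p)
    (ha : a.right ≠ p → side a.right = d) : ∀ b ∈ l, side b.left = d := by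
  induction l generalizing a with
  | nil => simp
  | cons b l ih =>
    obtain ⟨hab, hchain⟩ := List.isChain_cons_cons.1 hchain
    obtain ⟨hb, hl⟩ := List.forall_mem_cons.1 hl
    have hbd : side b.left = d := hab ▸ ha (hab ▸ hb)
    exact List.forall_mem_cons.2 ⟨hbd, ih hchain hl fun hr => (hside b hb hr).trans hbd⟩

/-- The quiver with an arrow from `x` to `s c x` for each point `x` and each index `c`. -/
def OrbitQuiver {ι P : Type*} (_s : ι → Equiv.Perm P) : Type _ := P

namespace OrbitQuiver

variable {ι P : Type*} (s : ι → Equiv.Perm P)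

instance [Fintype P] : Fintype (OrbitQuiver s) := inferInstanceAs (Fintype P)

instance : Quiver (OrbitQuiver s) := ⟨fun x y => {c : ι // s c x = y}⟩

/-- The arrows of the quiver, as pairs of an index and a starting point. -/
def arrowEquiv : ι × P ≃ Quiver.Total (OrbitQuiver s) where
  toFun p := ⟨p.2, s p.1 p.2, ⟨p.1, rfl⟩⟩
  invFun a := (a.hom.1, a.left)
  left_inv _ := rfl
  right_inv := by
    rintro ⟨x, y, c, rfl⟩
    rfl

variable {s}

theorem arrow_apply_mem_of_isCactus [Finite P] (h : IsCactus s (id : P → P))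
    {Z : Cycle (Quiver.Total (OrbitQuiver s))} (hZ : IsQuiverCycle Z) (c : ι) (x : P)
    (hx : arrowEquiv s (c, x) ∈ Z) : arrowEquiv s (c, s c x) ∈ Z := by
  obtain ⟨b, hb, hbx⟩ := hZ.exists_left_eq_right hx
  obtain ⟨⟨d, p⟩, rfl⟩ := (arrowEquiv s).surjective b
  obtain rfl : p = s c x := hbx
  suffices d = c from this ▸ hb
  obtain ⟨l, rfl⟩ := exists_coe_cons_eq_of_mem hb
  rcases List.mem_cons.1 (Cycle.mem_coe_iff.1 hx) with heq | hxl
  · exact (Prod.mk.inj ((arrowEquiv s).injective heq)).1.symm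
  have hne : ∀ b ∈ l, b.left ≠ s c x := fun b hbl hbx =>
    (List.nodup_cons.1 (Cycle.nodup_coe_iff.1 hZ.nodup)).1 (List.mem_map.2 ⟨b, hbl, hbx⟩)
  obtain ⟨side, hline, hside⟩ := h.exists_sameCycle_side (s c x)
  have hc : side x = c := hline c x (Equiv.Perm.sameCycle_apply_left.2 .rfl) (hne _ hxl)
  have hd : side x = d := by
    have hchain := (Cycle.chain_coe_cons _ _ _).1 hZ.chain
    rw [← List.cons_append] at hchain
    refine side_left_eq_of_isChain (fun a => ?_) hchain.left_of_append hne ?_ _ hxl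
    · obtain ⟨⟨b, y⟩, rfl⟩ := (arrowEquiv s).surjective a
      exact hside b y
    · exact hline d _ (Equiv.Perm.sameCycle_apply_right.2 .rfl)
  exact hd.symm.trans hc

/-- Each cycle of the quiver of a cactus runs along an orbit. -/
def cyclePresentation [Finite P] (h : IsCactus s (id : P → P)) :
    CyclePresentation s (OrbitQuiver s) where
  point := Equiv.refl P
  arrow := arrowEquiv s
  left _ _ := rfl
  right _ _ := rfl
  closed _ hZ := arrow_apply_mem_of_isCactus h hZ

end OrbitQuiver

namespace CyclePresentation

variable {ι P : Type*} {s : ι → Equiv.Perm P} {V : Type u} [Quiver.{v} V]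
  (m : CyclePresentation s V)

theorem exists_eq_lineArrows {Z : Cycle (Quiver.Total V)} (hZ : IsQuiverCycle Z) {x : P}
    (hx : m.point x ∈ Z.map Quiver.Total.left) : ∃ c, Z = m.lineArrows c x := by
  obtain ⟨a, ha, hax⟩ := Cycle.mem_map.1 hx
  obtain ⟨⟨c, y⟩, rfl⟩ := m.arrow.surjective a
  obtain rfl : y = x := m.point.injective (by rw [← m.left c, hax])
  exact ⟨c, m.eq_lineArrows hZ ha⟩

theorem sameCycle_of_mem_lineArrows {c : ι} {x y : P}
    (hy : m.point y ∈ (m.lineArrows c x : Cycle (Quiver.Total V)).map Quiver.Total.left) :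
    (s c).SameCycle x y := by
  obtain ⟨a, ha, hay⟩ := Cycle.mem_map.1 hy
  obtain ⟨n, -, rfl⟩ := List.mem_map.1 (Cycle.mem_coe_iff.1 ha)
  obtain rfl : (s c)^[n] x = y := m.point.injective (by rw [← m.left c, hay])
  exact ⟨n, congrFun (Equiv.Perm.coe_pow (s c) n) x⟩

theorem point_mem_lineArrows [Finite P] (c : ι) (x : P) :
    m.point x ∈ (m.lineArrows c x : Cycle (Quiver.Total V)).map Quiver.Total.left :=
  Cycle.mem_map.2 ⟨_, m.arrow_mem_lineArrows c x, m.left c x⟩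

theorem lineArrows_injective [Finite P] (x : P) :
    Function.Injective fun c => (m.lineArrows c x : Cycle (Quiver.Total V)) := by
  intro c d (hcd : (m.lineArrows c x : Cycle (Quiver.Total V)) = m.lineArrows d x)
  have hc : m.arrow (c, x) ∈ (m.lineArrows c x : Cycle (Quiver.Total V)) :=
    m.arrow_mem_lineArrows c x
  have hd : m.arrow (d, x) ∈ (m.lineArrows c x : Cycle (Quiver.Total V)) :=
    hcd ▸ m.arrow_mem_lineArrows d x
  have heq := (m.isQuiverCycle_lineArrows c x).eq_of_left_eq hc hd (by rw [m.left, m.left])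
  exact (Prod.mk.inj (m.arrow.injective heq)).1

theorem ncard_cycles [Finite P] (x : P) :
    {Z : Cycle (Quiver.Total V) | IsQuiverCycle Z ∧ m.point x ∈ Z.map Quiver.Total.left}.ncard =
      Nat.card ι := by
  have hrange : {Z : Cycle (Quiver.Total V) |
      IsQuiverCycle Z ∧ m.point x ∈ Z.map Quiver.Total.left} =
      Set.range fun c => (m.lineArrows c x : Cycle (Quiver.Total V)) := by
    ext Z
    refine ⟨fun ⟨hZ, hx⟩ => ?_, ?_⟩
    · obtain ⟨c, rfl⟩ := m.exists_eq_lineArrows hZ hx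
      exact ⟨c, rfl⟩
    · rintro ⟨c, rfl⟩
      exact ⟨m.isQuiverCycle_lineArrows c x, m.point_mem_lineArrows c x⟩
  rw [hrange, ← Nat.card_coe_set_eq, Nat.card_range_of_injective (m.lineArrows_injective x)]

theorem eq_of_mem_of_mem_of_ne [Finite P] (h : IsCactus s (id : P → P))
    {Z Z' : Cycle (Quiver.Total V)} (hZ : IsQuiverCycle Z) (hZ' : IsQuiverCycle Z') (hne : Z ≠ Z')
    {x y : P} (hx : m.point x ∈ Z.map Quiver.Total.left)
    (hx' : m.point x ∈ Z'.map Quiver.Total.left) (hy : m.point y ∈ Z.map Quiver.Total.left)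
    (hy' : m.point y ∈ Z'.map Quiver.Total.left) : x = y := by
  obtain ⟨c, rfl⟩ := m.exists_eq_lineArrows hZ hx
  obtain ⟨d, rfl⟩ := m.exists_eq_lineArrows hZ' hx'
  obtain ⟨side, hline, -⟩ := h.exists_sameCycle_side x
  by_contra hxy
  have hc : side y = c := hline c y (m.sameCycle_of_mem_lineArrows hy) (Ne.symm hxy)
  have hd : side y = d := hline d y (m.sameCycle_of_mem_lineArrows hy') (Ne.symm hxy)
  exact hne (by rw [← hc, ← hd])

end CyclePresentation

theorem card_pedigreeStep : Nat.card PedigreeStep = 2 :=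
  Nat.card_eq_two_iff.2
    ⟨.alpha, .betaInv, nofun, Set.eq_univ_of_forall fun c => by cases c <;> simp⟩

namespace Pedigree

variable (L : Pedigree)

theorem eqvGen_root (x : OrbitQuiver L.next) :
    Relation.EqvGen (fun a b : OrbitQuiver L.next => Nonempty (a ⟶ b)) x ⟨[], L.root_mem⟩ := by
  obtain ⟨x, hx⟩ := x
  induction x with
  | nil => exact .refl _
  | cons c x ih =>
    have hx' := L.parent_mem c x hx
    refine .trans _ _ _ ?_ (ih hx')
    cases c
    · exact .symm _ _ (.rel _ _ ⟨⟨.alpha, climb_of_mem (x := ⟨x, hx'⟩) hx⟩⟩)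
    · exact .rel _ _ ⟨⟨.betaInv, next_betaInv_of_mem (x := ⟨x, hx'⟩) hx⟩⟩

/-- The points of a pedigree with their arrows along the closed lines, presented by `L.next`. -/
def cyclePresentation : CyclePresentation L.next (OrbitQuiver L.next) :=
  OrbitQuiver.cyclePresentation L.isCactus_next

/-- The Brauer-quiver obtained by closing up the lines of a pedigree. -/
def brauerQuiver : BrauerQuiver.{0, 0} where
  Point := OrbitQuiver L.next
  finite_arrows := Finite.of_equiv _ (OrbitQuiver.arrowEquiv L.next)
  nonempty := ⟨⟨[], L.root_mem⟩⟩
  connected x y := .trans _ _ _ (L.eqvGen_root x) (.symm _ _ (L.eqvGen_root y))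
  arrow_mem_cycle := L.cyclePresentation.arrow.forall_congr_right.1 fun ⟨c, x⟩ =>
    ⟨_, L.cyclePresentation.isQuiverCycle_lineArrows c x,
      L.cyclePresentation.arrow_mem_lineArrows c x⟩
  two_cycles x := (L.cyclePresentation.ncard_cycles x).trans card_pedigreeStep
  meet _ _ hZ hZ' hne _ _ := L.cyclePresentation.eq_of_mem_of_mem_of_ne L.isCactus_next hZ hZ' hne

end Pedigree

/-! ### The successor of an arrow in a Brauer-quiver -/

theorem IsQuiverCycle.eq_singleton_of_loop {V : Type u} [Quiver.{v} V]
    {Z : Cycle (Quiver.Total V)} (hZ : IsQuiverCycle Z) {a : Quiver.Total V} (ha : a ∈ Z)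
    (hloop : a.left = a.right) : Z = ↑[a] := by
  obtain ⟨l, rfl⟩ := exists_coe_cons_eq_of_mem ha
  rcases l with _ | ⟨b, l⟩
  · rfl
  · have hab := (List.isChain_cons_cons.1 ((Cycle.chain_coe_cons _ _ _).1 hZ.chain)).1
    have hnodup := (List.nodup_cons.1 (Cycle.nodup_coe_iff.1 hZ.nodup)).1
    exact absurd (List.mem_map.2 ⟨b, List.mem_cons_self, (hloop.trans hab).symm⟩) hnodup

namespace BrauerQuiver

variable {Q : BrauerQuiver.{u, v}}

theorem cycle_unique {a : Quiver.Total Q.Point} {Z Z' : Cycle (Quiver.Total Q.Point)}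
    (hZ : IsQuiverCycle Z) (hZ' : IsQuiverCycle Z') (ha : a ∈ Z) (ha' : a ∈ Z') : Z = Z' := by
  by_contra hne
  obtain ⟨b, hb, hba⟩ := hZ.exists_left_eq_right ha
  obtain ⟨b', hb', hba'⟩ := hZ'.exists_left_eq_right ha'
  have hloop : a.left = a.right := Q.meet Z Z' hZ hZ' hne _ _ (Cycle.mem_map.2 ⟨a, ha, rfl⟩)
    (Cycle.mem_map.2 ⟨a, ha', rfl⟩) (Cycle.mem_map.2 ⟨b, hb, hba⟩)
    (Cycle.mem_map.2 ⟨b', hb', hba'⟩)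
  exact hne ((hZ.eq_singleton_of_loop ha hloop).trans (hZ'.eq_singleton_of_loop ha' hloop).symm)

theorem exists_nextArrow (a : Quiver.Total Q.Point) : ∃ b : Quiver.Total Q.Point,
    b.left = a.right ∧ ∀ Z : Cycle (Quiver.Total Q.Point), IsQuiverCycle Z → a ∈ Z → b ∈ Z := by
  obtain ⟨Z, hZ, ha⟩ := Q.arrow_mem_cycle a
  obtain ⟨b, hb, hba⟩ := hZ.exists_left_eq_right ha
  exact ⟨b, hba, fun Z' hZ' ha' => cycle_unique hZ hZ' ha ha' ▸ hb⟩

instance : Finite (Quiver.Total Q.Point) := Q.finite_arrows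

theorem surjective_choose_exists_nextArrow :
    Function.Surjective fun a : Quiver.Total Q.Point => (exists_nextArrow a).choose := by
  intro a
  obtain ⟨Z, hZ, ha⟩ := Q.arrow_mem_cycle a
  obtain ⟨l, rfl⟩ := exists_coe_cons_eq_of_mem ha
  have hlen := congrArg List.length (hZ.cons_eq_map_iterate
    (fun b => (exists_nextArrow b).choose_spec.1) fun b => (exists_nextArrow b).choose_spec.2 _ hZ)
  rw [List.length_cons, List.length_map, List.length_range] at hlen
  have hper := Function.iterate_minimalPeriod
    (f := fun b : Quiver.Total Q.Point => (exists_nextArrow b).choose) (x := a)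
  rw [← hlen, Function.iterate_succ_apply'] at hper
  exact ⟨_, hper⟩

variable (Q) in
/-- The permutation that takes an arrow to the next arrow of its cycle. -/
def nextArrow : Equiv.Perm (Quiver.Total Q.Point) :=
  Equiv.ofBijective _ (Finite.surjective_iff_bijective.1
    (surjective_choose_exists_nextArrow (Q := Q)))

theorem nextArrow_left (a : Quiver.Total Q.Point) : (Q.nextArrow a).left = a.right :=
  (exists_nextArrow a).choose_spec.1

theorem nextArrow_mem {a : Quiver.Total Q.Point} {Z : Cycle (Quiver.Total Q.Point)}
    (hZ : IsQuiverCycle Z) (ha : a ∈ Z) : Q.nextArrow a ∈ Z :=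
  (exists_nextArrow a).choose_spec.2 Z hZ ha

theorem mem_iff_sameCycle {a b : Quiver.Total Q.Point} {Z : Cycle (Quiver.Total Q.Point)}
    (hZ : IsQuiverCycle Z) (ha : a ∈ Z) : b ∈ Z ↔ Q.nextArrow.SameCycle a b := by
  constructor
  · intro hb
    obtain ⟨l, rfl⟩ := exists_coe_cons_eq_of_mem ha
    rw [Cycle.mem_coe_iff, hZ.cons_eq_map_iterate nextArrow_left fun b hb => nextArrow_mem hZ hb,
      List.mem_map] at hb
    obtain ⟨n, -, rfl⟩ := hb
    exact ⟨n, congrFun (Equiv.Perm.coe_pow Q.nextArrow n) a⟩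
  · intro hab
    obtain ⟨n, rfl⟩ := hab.exists_nat_pow_eq
    clear hab
    induction n with
    | zero => exact ha
    | succ n ih => exact pow_succ' Q.nextArrow n ▸ nextArrow_mem hZ ih

theorem eq_of_sameCycle {a b : Quiver.Total Q.Point} (h : Q.nextArrow.SameCycle a b)
    (hab : a.left = b.left) : a = b := by
  obtain ⟨Z, hZ, ha⟩ := Q.arrow_mem_cycle a
  exact hZ.eq_of_left_eq ha ((mem_iff_sameCycle hZ ha).2 h) hab

/-! ### The two arrows starting in a point -/

theorem card_arrows_from (x : Q.Point) : Nat.card {a : Quiver.Total Q.Point // a.left = x} = 2 := by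
  rw [← Q.two_cycles x, ← Nat.card_coe_set_eq]
  choose Z hZ hmem using Q.arrow_mem_cycle
  refine Nat.card_congr (Equiv.ofBijective
    (fun a => ⟨Z a.1, hZ a.1, Cycle.mem_map.2 ⟨a.1, hmem a.1, a.2⟩⟩) ⟨fun a b hab => ?_, ?_⟩)
  · have hZab : Z a.1 = Z b.1 := congrArg Subtype.val hab
    exact Subtype.ext ((hZ a.1).eq_of_left_eq (hmem a.1) (hZab ▸ hmem b.1) (a.2.trans b.2.symm))
  · rintro ⟨W, hW, hx⟩
    obtain ⟨a, ha, hax⟩ := Cycle.mem_map.1 hx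
    exact ⟨⟨a, hax⟩, Subtype.ext (cycle_unique (hZ a) hW (hmem a) ha)⟩

theorem existsUnique_otherArrow (a : Quiver.Total Q.Point) :
    ∃! b : Quiver.Total Q.Point, b.left = a.left ∧ b ≠ a := by
  obtain ⟨b, hb, huniq⟩ := (Nat.card_eq_two_iff' ⟨a, rfl⟩).1 (card_arrows_from a.left)
  refine ⟨b, ⟨b.2, fun h => hb (Subtype.ext h)⟩, fun c hc => ?_⟩
  exact congrArg Subtype.val (huniq ⟨c, hc.1⟩ fun h => hc.2 (congrArg Subtype.val h))

variable (Q) in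
/-- The permutation that takes an arrow to the other arrow with the same starting point. -/
def otherArrow : Equiv.Perm (Quiver.Total Q.Point) :=
  Function.Involutive.toPerm (fun a => (existsUnique_otherArrow a).choose) fun a =>
    have h := (existsUnique_otherArrow a).choose_spec.1
    (existsUnique_otherArrow _).unique (existsUnique_otherArrow _).choose_spec.1
      ⟨h.1.symm, h.2.symm⟩

@[simp]
theorem otherArrow_left (a : Quiver.Total Q.Point) : (Q.otherArrow a).left = a.left :=
  (existsUnique_otherArrow a).choose_spec.1.1

theorem otherArrow_ne (a : Quiver.Total Q.Point) : Q.otherArrow a ≠ a :=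
  (existsUnique_otherArrow a).choose_spec.1.2

@[simp]
theorem otherArrow_otherArrow (a : Quiver.Total Q.Point) : Q.otherArrow (Q.otherArrow a) = a :=
  Function.Involutive.toPerm_involutive _ a

theorem eq_or_eq_otherArrow {a b : Quiver.Total Q.Point} (h : b.left = a.left) :
    b = a ∨ b = Q.otherArrow a :=
  or_iff_not_imp_left.2 fun hne =>
    (existsUnique_otherArrow a).unique ⟨h, hne⟩ ⟨otherArrow_left a, otherArrow_ne a⟩

end BrauerQuiver

/-! ### Points of a Brauer-quiver are cut points -/

/-- A path from `y` to `z` all whose points are different from `p`. -/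
def ReachesAvoiding {V : Type u} [Quiver.{v} V] (p : V) : V → V → Prop :=
  Relation.ReflTransGen fun y z => y ≠ p ∧ z ≠ p ∧ Nonempty (y ⟶ z)

theorem exists_nodup_isChain {V : Type u} [Quiver.{v} V] {p y : V} {g : Quiver.Total V}
    (hg : g.left ≠ p) (h : ReachesAvoiding p y g.left) :
    ∃ (a : Quiver.Total V) (l : List (Quiver.Total V)),
      (a :: l).IsChain (fun a b => a.right = b.left) ∧ a.left = y ∧ [g] <:+ a :: l ∧
      ((a :: l).map Quiver.Total.left).Nodup ∧ ∀ b ∈ a :: l, b.left ≠ p := by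
  induction h using Relation.ReflTransGen.head_induction_on with
  | refl => exact ⟨g, [], by simp, rfl, List.suffix_rfl, by simp, by simpa using hg⟩
  | @head y z hyz _ ih =>
    obtain ⟨a, l, hchain, rfl, hlast, hnodup, hp⟩ := ih
    obtain ⟨hyp, -, ⟨r⟩⟩ := hyz
    by_cases hy : y ∈ (a :: l).map Quiver.Total.left
    · obtain ⟨b, hb, rfl⟩ := List.mem_map.1 hy
      obtain ⟨l₁, l₂, hl⟩ := List.append_of_mem hb
      have hsuff : b :: l₂ <:+ a :: l := ⟨l₁, hl.symm⟩
      exact ⟨b, l₂, hchain.suffix hsuff, rfl,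
        List.suffix_of_suffix_length_le hlast hsuff (by simp),
        hnodup.sublist (hsuff.sublist.map _), fun b' hb' => hp b' (hsuff.subset hb')⟩
    · exact ⟨⟨y, a.left, r⟩, a :: l, List.isChain_cons_cons.2 ⟨rfl, hchain⟩, rfl,
        hlast.trans (List.suffix_cons _ _), List.nodup_cons.2 ⟨hy, hnodup⟩,
        List.forall_mem_cons.2 ⟨hyp, hp⟩⟩

theorem exists_isQuiverCycle_of_reachesAvoiding {V : Type u} [Quiver.{v} V]
    {e g : Quiver.Total V} (h : ReachesAvoiding e.left e.right g.left) (hg : g.left ≠ e.left)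
    (hge : g.right = e.left) :
    ∃ Z : Cycle (Quiver.Total V), IsQuiverCycle Z ∧ e ∈ Z ∧ g ∈ Z := by
  obtain ⟨a, l, hchain, ha, ⟨t, ht⟩, hnodup, hne⟩ := exists_nodup_isChain hg h
  refine ⟨↑(e :: a :: l), ⟨by simp, ?_, ?_⟩, by simp, ?_⟩
  · rw [Cycle.chain_coe_cons, List.cons_append, List.isChain_cons_cons, ← List.cons_append,
      List.isChain_append, ← ht]
    refine ⟨ha.symm, ht ▸ hchain, by simp, ?_⟩
    simpa using hge
  · refine List.nodup_cons.2 ⟨fun he => ?_, hnodup⟩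
    obtain ⟨b, hb, hbe⟩ := List.mem_map.1 he
    exact hne b hb hbe
  · rw [Cycle.mem_coe_iff, ← ht]
    simp

namespace BrauerQuiver

variable {Q : BrauerQuiver.{u, v}}

/-- There is a path from the end of `e` to `y` that avoids the starting point of `e`. -/
def OnSide (e : Quiver.Total Q.Point) (y : Q.Point) : Prop :=
  e.right ≠ e.left ∧ ReachesAvoiding e.left e.right y

variable {e a : Quiver.Total Q.Point}

theorem OnSide.ne {y : Q.Point} (h : OnSide e y) : y ≠ e.left := by
  rcases Relation.ReflTransGen.cases_tail h.2 with heq | ⟨z, -, hz⟩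
  · exact heq ▸ h.1
  · exact hz.2.1

theorem OnSide.right (h : OnSide e a.left) (ha : a.right ≠ e.left) : OnSide e a.right :=
  ⟨h.1, h.2.tail ⟨h.ne, ha, ⟨a.hom⟩⟩⟩

theorem OnSide.sameCycle (h : OnSide e a.left) (ha : a.right = e.left) :
    Q.nextArrow.SameCycle e a := by
  obtain ⟨Z, hZ, he, haZ⟩ := exists_isQuiverCycle_of_reachesAvoiding h.2 h.ne ha
  exact (mem_iff_sameCycle hZ he).1 haZ

theorem onSide_of_sameCycle (h : Q.nextArrow.SameCycle e a) (ha : a.left ≠ e.left) :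
    OnSide e a.left := by
  obtain ⟨n, rfl⟩ := h.exists_nat_pow_eq
  clear h
  induction n with
  | zero => exact absurd rfl ha
  | succ n ih =>
    rw [pow_succ', Equiv.Perm.mul_apply, nextArrow_left] at ha ⊢
    by_cases h : ((Q.nextArrow ^ n) e).left = e.left
    · have hen : e = (Q.nextArrow ^ n) e := eq_of_sameCycle ⟨n, rfl⟩ h.symm
      rw [← hen] at ha ⊢
      exact ⟨ha, .refl⟩
    · exact (ih h).right ha

theorem OnSide.of_sameCycle {b : Quiver.Total Q.Point} (h : OnSide e a.left)
    (hea : ¬ Q.nextArrow.SameCycle e a) (hab : Q.nextArrow.SameCycle a b) : OnSide e b.left := by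
  obtain ⟨n, rfl⟩ := hab.exists_nat_pow_eq
  clear hab
  induction n with
  | zero => exact h
  | succ n ih =>
    rw [pow_succ', Equiv.Perm.mul_apply, nextArrow_left]
    exact ih.right fun hr => hea (Equiv.Perm.sameCycle_pow_right.1 (ih.sameCycle hr))

theorem onSide_right_iff (hl : a.left ≠ e.left) (hr : a.right ≠ e.left) :
    OnSide e a.right ↔ OnSide e a.left := by
  refine ⟨fun h => ?_, fun h => h.right hr⟩
  by_cases hea : Q.nextArrow.SameCycle e a
  · exact onSide_of_sameCycle hea hl
  · rw [← nextArrow_left] at h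
    exact h.of_sameCycle (fun hen => hea (Equiv.Perm.sameCycle_apply_right.1 hen))
      (Equiv.Perm.sameCycle_apply_left.2 .rfl)

/-! ### The cactus of a Brauer-quiver -/

variable (Q) in
/-- The permutations of the arrows which make a Brauer-quiver into a cactus. An arrow stands for
its starting point, together with the choice of the cycle through it that is called `alpha` there;
`Q.turn c` follows the cycle called `c`, which in the case of `betaInv` happens backwards. -/
def turn : PedigreeStep → Equiv.Perm (Quiver.Total Q.Point)
  | .alpha => Q.nextArrow
  | .betaInv => Q.otherArrow * Q.nextArrow⁻¹ * Q.otherArrow⁻¹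

theorem nextArrow_otherArrow_turn (a : Quiver.Total Q.Point) :
    Q.nextArrow (Q.otherArrow (Q.turn .betaInv a)) = Q.otherArrow a := by
  have hinv : Q.otherArrow.symm a = Q.otherArrow a :=
    (Equiv.symm_apply_eq _).2 (otherArrow_otherArrow a).symm
  simp [turn, hinv]

theorem right_otherArrow_turn (a : Quiver.Total Q.Point) :
    (Q.otherArrow (Q.turn .betaInv a)).right = a.left := by
  rw [← nextArrow_left, nextArrow_otherArrow_turn, otherArrow_left]

theorem onSide_turn_iff (c : PedigreeStep) (ha : a.left ≠ e.left)
    (hca : (Q.turn c a).left ≠ e.left) : OnSide e (Q.turn c a).left ↔ OnSide e a.left := by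
  cases c
  · have hnext : (Q.turn .alpha a).left = a.right := nextArrow_left a
    rw [hnext] at hca ⊢
    exact onSide_right_iff ha hca
  · have h := onSide_right_iff (e := e) (a := Q.otherArrow (Q.turn .betaInv a))
    rw [right_otherArrow_turn, otherArrow_left] at h
    exact (h hca ha).symm

theorem onSide_turn_self_iff (c : PedigreeStep) (hce : (Q.turn c e).left ≠ e.left) :
    OnSide e (Q.turn c e).left ↔ c = .alpha := by
  cases c
  · exact iff_of_true (onSide_of_sameCycle (Equiv.Perm.sameCycle_apply_right.2 .rfl) hce) rfl
  · refine iff_of_false (fun h => otherArrow_ne e ?_) nofun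
    rw [← otherArrow_left] at h
    have hsame := Equiv.Perm.sameCycle_apply_right.2 (h.sameCycle (right_otherArrow_turn e))
    rw [nextArrow_otherArrow_turn] at hsame
    exact (eq_of_sameCycle hsame (otherArrow_left e).symm).symm

theorem eq_of_sameCycle_turn {c : PedigreeStep} {a b : Quiver.Total Q.Point}
    (h : (Q.turn c).SameCycle a b) (hab : a.left = b.left) : a = b := by
  cases c
  · exact eq_of_sameCycle h hab
  · have hconj := Equiv.Perm.sameCycle_inv.1 (Equiv.Perm.sameCycle_conj.1 h)
    exact Q.otherArrow⁻¹.injective (eq_of_sameCycle hconj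
      ((otherArrow_left a).trans (hab.trans (otherArrow_left b).symm)))

open scoped Classical in
variable (Q) in
theorem isCactus_turn : IsCactus Q.turn (Quiver.Total.left : _ → Q.Point) where
  eq_of_sameCycle := eq_of_sameCycle_turn
  exists_side e := by
    refine ⟨fun y => if OnSide e y then .alpha else .betaInv, fun c hce => ?_,
      fun c a ha hca => if_congr (onSide_turn_iff c ha hca) rfl rfl⟩
    simp only [onSide_turn_self_iff c hce]
    cases c <;> rfl

/-! ### The pedigree of a Brauer-quiver -/

variable (e) in
/-- The pedigree formed by the simple walks in the cactus that start with `e`. -/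
abbrev pedigree : Pedigree := Q.isCactus_turn.pedigree e

variable (e) in
/-- The arrow of the kind `c` starting in the end point of a simple walk. -/
def pedigreeArrow : PedigreeStep × (pedigree e).Point → Quiver.Total Q.Point
  | (.alpha, x) => walk Q.turn e x.1
  | (.betaInv, x) => Q.otherArrow (walk Q.turn e x.1)

theorem pedigreeArrow_left (c : PedigreeStep) (x : (pedigree e).Point) :
    (pedigreeArrow e (c, x)).left = (walk Q.turn e x.1).left := by
  cases c
  · rfl
  · exact otherArrow_left _

theorem nextArrow_pedigreeArrow (c : PedigreeStep) (x : (pedigree e).Point) :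
    Q.nextArrow (pedigreeArrow e (c, x)) = pedigreeArrow e (c, (pedigree e).next c x) := by
  cases c
  · exact (Q.isCactus_turn.walk_climb .alpha x).symm
  · have hwalk := Q.isCactus_turn.walk_climb .betaInv ((pedigree e).next .betaInv x)
    rw [Pedigree.climb_next_betaInv] at hwalk
    rw [pedigreeArrow, hwalk, nextArrow_otherArrow_turn, pedigreeArrow]

theorem exists_pedigreeArrow_eq {x : (pedigree e).Point}
    (h : a.left = (walk Q.turn e x.1).left) : ∃ c, pedigreeArrow e (c, x) = a := by
  rcases eq_or_eq_otherArrow h with rfl | rfl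
  · exact ⟨.alpha, rfl⟩
  · exact ⟨.betaInv, rfl⟩

theorem exists_walk_left_eq_iff (a : Quiver.Total Q.Point) :
    (∃ x : (pedigree e).Point, (walk Q.turn e x.1).left = a.left) ↔
      ∃ x : (pedigree e).Point, (walk Q.turn e x.1).left = a.right := by
  constructor
  · rintro ⟨x, hx⟩
    obtain ⟨c, rfl⟩ := exists_pedigreeArrow_eq hx.symm
    exact ⟨(pedigree e).next c x, by
      rw [← nextArrow_left, nextArrow_pedigreeArrow, pedigreeArrow_left]⟩
  · rintro ⟨x, hx⟩
    rw [← nextArrow_left] at hx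
    obtain ⟨c, hc⟩ := exists_pedigreeArrow_eq hx.symm
    obtain ⟨z, rfl⟩ := ((pedigree e).next c).surjective x
    rw [← nextArrow_pedigreeArrow] at hc
    exact ⟨z, by rw [← Q.nextArrow.injective hc, pedigreeArrow_left]⟩

theorem exists_walk_left_eq (y : Q.Point) :
    ∃ x : (pedigree e).Point, (walk Q.turn e x.1).left = y := by
  have hiff : ∀ x y : Q.Point, Relation.EqvGen (fun a b => Nonempty (a ⟶ b)) x y →
      ((∃ z : (pedigree e).Point, (walk Q.turn e z.1).left = x) ↔
        ∃ z : (pedigree e).Point, (walk Q.turn e z.1).left = y) := by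
    intro x y h
    induction h with
    | rel x y h =>
      obtain ⟨r⟩ := h
      exact exists_walk_left_eq_iff ⟨x, y, r⟩
    | refl x => rfl
    | symm x y _ ih => exact ih.symm
    | trans x y z _ _ ih ih' => exact ih.trans ih'
  exact (hiff e.left y (Q.connected _ _)).1 ⟨⟨[], (pedigree e).root_mem⟩, rfl⟩

theorem bijective_walk_left :
    Function.Bijective fun x : (pedigree e).Point => (walk Q.turn e x.1).left :=
  ⟨Q.isCactus_turn.injective_walk_pedigree e, exists_walk_left_eq⟩

theorem bijective_pedigreeArrow : Function.Bijective (pedigreeArrow e) := by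
  constructor
  · rintro ⟨c, x⟩ ⟨d, y⟩ h
    obtain rfl : x = y := bijective_walk_left.1 <| by
      simpa only [pedigreeArrow_left] using congrArg Quiver.Total.left h
    cases c <;> cases d
    · rfl
    · exact absurd h.symm (otherArrow_ne _)
    · exact absurd h (otherArrow_ne _)
    · rfl
  · intro a
    obtain ⟨x, hx⟩ := exists_walk_left_eq (e := e) a.left
    obtain ⟨c, hc⟩ := exists_pedigreeArrow_eq hx.symm
    exact ⟨(c, x), hc⟩

variable (e) in
/-- The cycles of a Brauer-quiver are the closed lines of its pedigree. -/
def cyclePresentation : CyclePresentation (pedigree e).next Q.Point where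
  point := Equiv.ofBijective _ bijective_walk_left
  arrow := Equiv.ofBijective _ bijective_pedigreeArrow
  left := pedigreeArrow_left
  right c x := by
    rw [Equiv.ofBijective_apply, Equiv.ofBijective_apply, ← nextArrow_left,
      nextArrow_pedigreeArrow, pedigreeArrow_left]
  closed Z hZ c x h := by
    rw [Equiv.ofBijective_apply, ← nextArrow_pedigreeArrow]
    exact nextArrow_mem hZ h

variable (Q) in
theorem nonempty_arrow : Nonempty (Quiver.Total Q.Point) := by
  obtain ⟨x⟩ := Q.nonempty
  obtain ⟨a, -⟩ := Finite.card_pos_iff.1 ((card_arrows_from x).symm ▸ Nat.two_pos)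
  exact ⟨a⟩

end BrauerQuiver

end

theorem theorem17 (k : Type w) [Field k] :
    (∀ L : Pedigree, ∃ Q : BrauerQuiver.{0, 0},
      Nonempty (TrivialExtension k (L.algebra k) ≃ₐ[k] Q.algebra k)) ∧
    (∀ Q : BrauerQuiver.{u, v}, ∃ L : Pedigree,
      Nonempty (Q.algebra k ≃ₐ[k] TrivialExtension k (L.algebra k))) := by
  refine ⟨fun L => ⟨L.brauerQuiver, ⟨(L.cyclePresentation.algEquiv (Q := L.brauerQuiver) k).symm⟩⟩,
    fun Q => ?_⟩
  obtain ⟨e⟩ := Q.nonempty_arrow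
  exact ⟨BrauerQuiver.pedigree e, ⟨(BrauerQuiver.cyclePresentation e).algEquiv k⟩⟩
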